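/- Write $\hat f(\xi)=\int_{\mathbb R^3} f(x)e^{-2\pi i\xi\cdot x}\,dx$, and let $P_{12},P_{13},P_{23}$ be the maps of $\mathbb R^3$ that swap the two indicated coordinates. For real-valued $f\in L^2(\mathbb R^3)$ put $$\|f\|_{H^s}^2=\int_{\mathbb R^3}(1+4\pi^2|\xi|^2)^s|\hat f(\xi)|^2\,d\xi,\qquad \|f\|_{H^s\cap\dot H^{-1}}^2=\int_{\mathbb R^3}\frac{(1+4\pi^2|\xi|^2)^{s+1}}{4\pi^2|\xi|^2}|\hat f(\xi)|^2\,d\xi .$$ For $s\ge 0$ let $H^s_*$ be the space of all $f\in H^s(\mathbb R^3)$ with $$f(x)=-f(P_{23}x)\quad\text{and}\quad \xi_1\hat f(\xi)-\xi_2\hat f(P_{12}\xi)-\xi_3\hat f(P_{13}\xi)=0\qquad\text{almost everywhere,}$$ and let $H^s_*\cap\dot H^{-1}$ be the space of those $f\in H^s_*$ with $\|f\|_{H^s\cap\dot H^{-1}}<\infty$, with this norm. The single-component, permutation-symmetric Euler vorticity equation for $\omega_1=\omega_1(x,t)$ is $$\partial_t\omega_1+(u\cdot\nabla)\omega_1-(\omega\cdot\nabla)u_1=0,$$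 where $\omega(x)=\big(\omega_1(x),-\omega_1(P_{12}x),-\omega_1(P_{13}x)\big)$ and $u(x)=\int_{\mathbb R^3}G(x,y)\,\omega_1(y)\,dy$ with $$G(x,y)=\frac1{4\pi}\left[\frac{1}{|x-y|^3}\begin{pmatrix}0\\-x_3+y_3\\x_2-y_2\end{pmatrix}+\frac{1}{|x-P_{12}y|^3}\begin{pmatrix}-x_3+y_3\\0\\x_1-y_2\end{pmatrix}+\frac{1}{|x-P_{13}y|^3}\begin{pmatrix}x_2-y_2\\-x_1+y_3\\0\end{pmatrix}\right];$$ spatial derivatives are weak derivatives, and at each time the equation holds for almost every $x$. **Theorem.** For every $s>\frac32$ there is a constant $C_s>0$, depending only on $s$, such that the following holds. Let $T>0$ and let $$\omega_1,\tilde\omega_1\in C\big([0,T];H^s_*\cap\dot H^{-1}\big)\cap C^1\big([0,T];H^{s-1}_*\big)$$ be two solutions of the single-component, permutation-symmetric Euler vorticity equation, with initial data $\omega_1^0=\omega_1(\cdot,0)$ and $\tilde\omega_1^0=\tilde\omega_1(\cdot,0)$. Then for all $0\le t\le T$, $$\|(\omega_1-\tilde\omega_1)(\cdot,t)\|_{L^2}^2\le\|\omega_1^0-\tilde\omega_1^0\|_{L^2}^2\,\exp\left(C_s\int_0^t\|(\omega_1+\tilde\omega_1)(\cdot,\tau)\|_{H^s}\,d\tau\right).$$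 In particular, solutions are unique: if $\omega_1^0=\tilde\omega_1^0$, then $\omega_1(\cdot,t)=\tilde\omega_1(\cdot,t)$ for all $0\le t\le T$. -/

import Mathlib

open MeasureTheory Filter Topology Set
open scoped ENNReal FourierTransform ContDiff

namespace PermEuler

/-- Three-dimensional Euclidean space. Its coordinates are indexed by `0, 1, 2`, so the coordinate
written `x_i` on paper is `x (i - 1)`. -/
abbrev R3 : Type := EuclideanSpace ℝ (Fin 3)

/-- Real-valued square integrable functions on `ℝ³`. -/
abbrev L2 : Type := Lp ℝ 2 (volume : Measure R3)

noncomputable section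

/-! ### Coordinate swaps -/

/-- The swap permutation matrix exchanging coordinates `i` and `j`, as a linear isometry. -/
def swapMap (i j : Fin 3) : R3 ≃ₗᵢ[ℝ] R3 :=
  LinearIsometryEquiv.piLpCongrLeft 2 ℝ ℝ (Equiv.swap i j)

/-- `P₁₂ (x₁, x₂, x₃) = (x₂, x₁, x₃)`. -/
abbrev P12 : R3 ≃ₗᵢ[ℝ] R3 := swapMap 0 1

/-- `P₁₃ (x₁, x₂, x₃) = (x₃, x₂, x₁)`. -/
abbrev P13 : R3 ≃ₗᵢ[ℝ] R3 := swapMap 0 2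

/-- `P₂₃ (x₁, x₂, x₃) = (x₁, x₃, x₂)`. -/
abbrev P23 : R3 ≃ₗᵢ[ℝ] R3 := swapMap 1 2

theorem P12_apply (x : R3) : P12 x = !₂[x 1, x 0, x 2] := by
  ext k; fin_cases k <;> rfl

theorem P13_apply (x : R3) : P13 x = !₂[x 2, x 1, x 0] := by
  ext k; fin_cases k <;> rfl

theorem P23_apply (x : R3) : P23 x = !₂[x 0, x 2, x 1] := by
  ext k; fin_cases k <;> rfl

/-! ### Sobolev norms -/

/-- The Fourier transform `f̂(ξ) = ∫ f(x) e^{-2πi ξ·x} dx` of a real square integrable function. -/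
def hat (f : L2) : Lp ℂ 2 (volume : Measure R3) :=
  𝓕 (Complex.ofRealCLM.compLp f)

/-- The `H^s` norm, `‖f‖² = ∫ (1 + 4π²|ξ|²)^s |f̂(ξ)|² dξ`, with value `∞` off `H^s`. -/
def hsNorm (s : ℝ) (f : L2) : ℝ≥0∞ :=
  (∫⁻ ξ : R3, ENNReal.ofReal ((1 + 4 * Real.pi ^ 2 * ‖ξ‖ ^ 2) ^ s) * ‖hat f ξ‖ₑ ^ 2) ^ (1 / 2 : ℝ)

/-- The norm of `H^s ∩ Ḣ^{-1}`, `‖f‖² = ∫ (1 + 4π²|ξ|²)^{s+1} / (4π²|ξ|²) |f̂(ξ)|² dξ`, with value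
`∞` off this space. -/
def hsDotNorm (s : ℝ) (f : L2) : ℝ≥0∞ :=
  (∫⁻ ξ : R3, ENNReal.ofReal
      ((1 + 4 * Real.pi ^ 2 * ‖ξ‖ ^ 2) ^ (s + 1) / (4 * Real.pi ^ 2 * ‖ξ‖ ^ 2)) *
    ‖hat f ξ‖ₑ ^ 2) ^ (1 / 2 : ℝ)

/-- The constraints that cut out the first vorticity components of permutation symmetric,
divergence free fields: `f(x) = -f(P₂₃ x)` and
`ξ₁ f̂(ξ) - ξ₂ f̂(P₁₂ ξ) - ξ₃ f̂(P₁₃ ξ) = 0`, almost everywhere. -/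
def Constraint (f : L2) : Prop :=
  (∀ᵐ x : R3, f x = -f (P23 x)) ∧
  (∀ᵐ ξ : R3, (ξ 0 : ℂ) * hat f ξ - (ξ 1 : ℂ) * hat f (P12 ξ) - (ξ 2 : ℂ) * hat f (P13 ξ) = 0)

/-- The space `H^s_*` (used for `s ≥ 0`). -/
def HsStar (s : ℝ) : Set L2 := {f | hsNorm s f < ⊤ ∧ Constraint f}

/-- The constraint space `H^s_* ∩ Ḣ^{-1}` (used for `s ≥ 0`). -/
def HsStarDot (s : ℝ) : Set L2 := {f | hsDotNorm s f < ⊤ ∧ Constraint f}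

/-! ### Time regularity -/

/-- Continuity on `[0, T]` with respect to the norm `N`. -/
def ContInNorm (N : L2 → ℝ≥0∞) (T : ℝ) (f : ℝ → L2) : Prop :=
  ∀ t ∈ Icc 0 T, Tendsto (fun τ => N (f τ - f t)) (𝓝[Icc 0 T] t) (𝓝 0)

/-- `f'` is the time derivative of `f` on `[0, T]` with respect to the norm `N` (one-sided at the
end points). -/
def HasDerivInNorm (N : L2 → ℝ≥0∞) (T : ℝ) (f f' : ℝ → L2) : Prop :=
  ∀ t ∈ Icc 0 T,
    Tendsto (fun τ => N ((τ - t)⁻¹ • (f τ - f t) - f' t)) (𝓝[Icc 0 T \ {t}] t) (𝓝 0)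

/-! ### The equation -/

/-- `g` is the weak partial derivative `∂_j f` on `ℝ³`. -/
def IsWeakPartial (j : Fin 3) (f g : R3 → ℝ) : Prop :=
  LocallyIntegrable f ∧ LocallyIntegrable g ∧
  ∀ φ : R3 → ℝ, ContDiff ℝ ∞ φ → HasCompactSupport φ →
    ∫ x, f x * fderiv ℝ φ x (EuclideanSpace.single j 1) = -∫ x, g x * φ x

/-- The kernel of the permutation symmetric Biot-Savart law. -/
def kernelG (x y : R3) : R3 :=
  (1 / (4 * Real.pi)) •
    ((1 / ‖x - y‖ ^ 3) • (!₂[0, -x 2 + y 2, x 1 - y 1] : R3) +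
     (1 / ‖x - P12 y‖ ^ 3) • (!₂[-x 2 + y 2, 0, x 0 - y 1] : R3) +
     (1 / ‖x - P13 y‖ ^ 3) • (!₂[x 1 - y 1, -x 0 + y 2, 0] : R3))

/-- The velocity `u(x) = ∫ G(x, y) ω₁(y) dy` generated by the vorticity component `ω₁`. -/
def velocity (w : L2) (x : R3) : R3 := ∫ y : R3, w y • kernelG x y

/-- The vorticity vector `ω(x) = (ω₁(x), -ω₁(P₁₂ x), -ω₁(P₁₃ x))` generated by `ω₁`. -/
def vorticity (w : L2) (x : R3) : R3 := !₂[w x, -w (P12 x), -w (P13 x)]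

/-- The identity `∂_t ω₁ + (u·∇) ω₁ - (ω·∇) u₁ = 0` at a fixed time, almost everywhere in space,
where `w = ω₁`, `w' = ∂_t ω₁` and the spatial derivatives are weak derivatives. -/
def VorticityEqAt (w w' : L2) : Prop :=
  ∃ dw du : Fin 3 → R3 → ℝ,
    (∀ j, IsWeakPartial j w (dw j)) ∧
    (∀ j, IsWeakPartial j (fun x => velocity w x 0) (du j)) ∧
    ∀ᵐ x : R3, w' x + ∑ j, velocity w x j * dw j x - ∑ j, vorticity w x j * du j x = 0

/-- `ω₁ ∈ C([0,T]; H^s_* ∩ Ḣ^{-1}) ∩ C¹([0,T]; H^{s-1}_*)` is a solution of the single-component,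
permutation-symmetric Euler vorticity equation on `[0, T]`. -/
structure IsSolution (s T : ℝ) (w : ℝ → L2) : Prop where
  mem : ∀ t ∈ Icc 0 T, w t ∈ HsStarDot s
  cont : ContInNorm (hsDotNorm s) T w
  evolution : ∃ w' : ℝ → L2,
    (∀ t ∈ Icc 0 T, w' t ∈ HsStar (s - 1)) ∧
    ContInNorm (hsNorm (s - 1)) T w' ∧
    HasDerivInNorm (hsNorm (s - 1)) T w w' ∧
    ∀ t ∈ Icc 0 T, VorticityEqAt (w t) (w' t)

end

end PermEuler

/-! The nonlinearity is quadratic in `ω₁`. For two solutions w, v put g = w - v and h = w + v.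
Polarization turns the difference of the two equations into 2 ∂ₜg + u_g·∇h + u_h·∇g - ω_g·∇(u_h)₁ -
ω_h·∇(u_g)₁ = 0. Every nonlinear term contains g once and h once, so pairing with g in L² bounds the
derivative of ‖g‖² by C ‖h‖_{H^s} ‖g‖², and Grönwall's inequality gives the estimate. Uniqueness is
the case g(0) = 0.

The four terms, paired with g: the transport term u_h·∇g contributes nothing, because u_h is
divergence free (`sum_integral_transport`); in u_g·∇h the velocity is controlled only in Ḣ¹, by ‖g‖,
and ∇h in H^{s-1}, so the product estimate Ḣ¹·H^{s-1} ⊂ L² is needed, which holds for s > 3/2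
(`exists_trilinear_bound`, `exists_velocity_term_bound`); in the two stretching terms ∇u_h and ω_h
are bounded by a multiple of the L¹ norm of ĥ, hence by ‖h‖_{H^s} (`exists_integral_hat_bound`),
while ω_g and ∇u_g are controlled in L² by ‖g‖.

All of this rests on the transform of the velocity. Each entry of G is, up to sign, a component of
z/(4π|z|³) at x - y, x - P₁₂y or x - P₁₃y, or a sum of two such. Writing |z|⁻³ as a superposition of
Gaussians shows that this kernel acts as the multiplier -iξ_l/(2π|ξ|²)
(`integral_bsKernel_mul_fourierInv`, `velocity_eq`). The multiplier gains one derivative, and its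
curl structure gives incompressibility. -/

namespace PermEuler
noncomputable section

/-! ### The Fourier transform of square integrable functions -/

-- The L² transform agrees with that of tempered distributions, which is defined by this duality.
-- Almost everywhere identities between L² transforms are checked against Schwartz functions by
-- means of it.
open SchwartzMap in
theorem integral_schwartz_mul_fourier (f : Lp ℂ 2 (volume : Measure R3)) (φ : 𝓢(R3, ℂ)) :
    ∫ ξ, φ ξ * (𝓕 f : Lp ℂ 2 (volume : Measure R3)) ξ = ∫ x, 𝓕 φ x * f x := by
  have h := congrArg (fun T => T φ) (Lp.fourier_toTemperedDistribution_eq f)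
  simpa [TemperedDistribution.fourier_apply] using h.symm

open SchwartzMap in
theorem integral_schwartz_mul_fourierInv (f : Lp ℂ 2 (volume : Measure R3)) (φ : 𝓢(R3, ℂ)) :
    ∫ ξ, φ ξ * (𝓕⁻ f : Lp ℂ 2 (volume : Measure R3)) ξ = ∫ x, 𝓕⁻ φ x * f x := by
  have h := congrArg (fun T => T φ) (Lp.fourierInv_toTemperedDistribution_eq f)
  simpa [TemperedDistribution.fourierInv_apply] using h.symm

theorem locallyIntegrable_L2 {E : Type*} [NormedAddCommGroup E]
    (f : Lp E 2 (volume : Measure R3)) : LocallyIntegrable f :=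
  (Lp.memLp f).locallyIntegrable (by norm_num)

open SchwartzMap in
theorem ae_eq_of_integral_schwartz {f g : R3 → ℂ} (hf : LocallyIntegrable f)
    (hg : LocallyIntegrable g) (h : ∀ φ : 𝓢(R3, ℂ), ∫ x, φ x * f x = ∫ x, φ x * g x) :
    f =ᵐ[volume] g := by
  refine ae_eq_of_integral_contDiff_smul_eq hf hg fun φ hφ hc => ?_
  have hg₁ : HasCompactSupport (Complex.ofRealCLM ∘ φ) := hc.comp_left rfl
  have hg₂ : ContDiff ℝ ∞ (Complex.ofRealCLM ∘ φ) := by fun_prop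
  simpa using h (hg₁.toSchwartzMap hg₂)

theorem continuous_fourierInv_of_integrable {f : R3 → ℂ} (hf : Integrable f) :
    Continuous (𝓕⁻ f) :=
  VectorFourier.fourierIntegral_continuous (L := -innerₗ R3) Real.continuous_fourierChar
    (by simp only [LinearMap.neg_apply, innerₗ_apply_apply]; fun_prop) hf

theorem norm_fourierInv_le (f : R3 → ℂ) (x : R3) : ‖𝓕⁻ f x‖ ≤ ∫ ξ, ‖f ξ‖ :=
  VectorFourier.norm_fourierIntegral_le_integral_norm _ _ (-innerₗ R3) _ _

/-- Self-adjointness of the inverse Fourier integral. -/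
theorem integral_fourierInv_mul {f g : R3 → ℂ} (hf : Integrable f) (hg : Integrable g) :
    ∫ x, 𝓕⁻ f x * g x = ∫ x, f x * 𝓕⁻ g x := by
  have h := VectorFourier.integral_fourierIntegral_smul_eq_flip (L := -innerₗ R3)
    Real.continuous_fourierChar
    (by simp only [LinearMap.neg_apply, innerₗ_apply_apply]; fun_prop) hf hg
  have e : (-innerₗ R3).flip = -innerₗ R3 := by
    refine LinearMap.ext fun x => LinearMap.ext fun y => ?_
    simp [real_inner_comm]
  rw [e] at h
  exact h

open SchwartzMap in
/-- The inverse Fourier transform of an `L¹ ∩ L²` function is given by the integral. -/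
theorem fourierInv_ae_eq {f : Lp ℂ 2 (volume : Measure R3)} (hf : Integrable f) :
    (𝓕⁻ f : Lp ℂ 2 (volume : Measure R3)) =ᵐ[volume] 𝓕⁻ (f : R3 → ℂ) := by
  refine ae_eq_of_integral_schwartz (locallyIntegrable_L2 _)
    (continuous_fourierInv_of_integrable hf).locallyIntegrable fun φ => ?_
  rw [integral_schwartz_mul_fourierInv, fourierInv_coe]
  exact integral_fourierInv_mul φ.integrable hf

-- By duality: translating the test function multiplies its transform by the character.
open SchwartzMap in
theorem fourier_modulation {f g : Lp ℂ 2 (volume : Measure R3)} (ξ : R3)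
    (h : ∀ᵐ x, g x = (Real.fourierChar (inner ℝ ξ x) : ℂ) * f x) :
    ∀ᵐ η, (𝓕 g : Lp ℂ 2 (volume : Measure R3)) η =
      (𝓕 f : Lp ℂ 2 (volume : Measure R3)) (η - ξ) := by
  refine ae_eq_of_integral_schwartz (locallyIntegrable_L2 _) ?_ fun φ => ?_
  · have := ((Lp.memLp (𝓕 f)).comp_measurePreserving (measurePreserving_sub_right volume ξ))
    exact this.locallyIntegrable (by norm_num)
  · rw [integral_schwartz_mul_fourier]
    have h1 := integral_schwartz_mul_fourier f (φ.compSubConstCLM ℂ (-ξ))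
    rw [← integral_sub_right_eq_self _ ξ] at h1
    simp only [compSubConstCLM_apply, sub_neg_eq_add, sub_add_cancel] at h1
    rw [h1]
    refine integral_congr_ae ?_
    filter_upwards [h] with x hx
    have := congrFun (VectorFourier.fourierIntegral_comp_add_right Real.fourierChar volume
      (innerₗ R3) φ ξ) x
    have h2 : 𝓕 (φ.compSubConstCLM ℂ (-ξ)) x = (Real.fourierChar (inner ℝ ξ x) : ℂ) * 𝓕 φ x := by
      rw [fourier_coe, fourier_coe]
      have e : (φ.compSubConstCLM ℂ (-ξ) : R3 → ℂ) = (φ : R3 → ℂ) ∘ fun v => v + ξ := by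
        ext y; simp
      rw [e]
      exact this
    rw [hx, h2]
    ring

/-! ### Weak derivatives on the Fourier side -/

open SchwartzMap LineDeriv in
theorem integral_lineDeriv_mul {f d : Lp ℂ 2 (volume : Measure R3)} (j : Fin 3)
    (hd : ∀ᵐ ξ, (𝓕 d : Lp ℂ 2 (volume : Measure R3)) ξ = 2 * Real.pi * Complex.I * (ξ j : ℂ) *
      (𝓕 f : Lp ℂ 2 (volume : Measure R3)) ξ) (φ : 𝓢(R3, ℂ)) :
    ∫ x, (∂_{EuclideanSpace.single j (1 : ℝ)} φ) x * f x = -∫ x, φ x * d x := by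
  have h1 := integral_schwartz_mul_fourierInv (𝓕 f) (∂_{EuclideanSpace.single j (1 : ℝ)} φ)
  have h2 := integral_schwartz_mul_fourierInv (𝓕 d) φ
  rw [FourierTransform.fourierInv_fourier_eq] at h1 h2
  rw [h1, h2, ← integral_neg]
  refine integral_congr_ae ?_
  filter_upwards [hd] with ξ hξ
  have ht : (fun x : R3 => inner ℝ x (EuclideanSpace.single j (1 : ℝ))).HasTemperateGrowth := by
    fun_prop
  rw [hξ, fourierInv_lineDerivOp_eq, smul_apply,
    smulLeftCLM_apply_apply ht]
  simp [EuclideanSpace.inner_single_right]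
  ring

theorem isWeakPartial_ae_eq {j : Fin 3} {f g g' : R3 → ℝ} (h : IsWeakPartial j f g)
    (h' : IsWeakPartial j f g') : g =ᵐ[volume] g' := by
  refine ae_eq_of_integral_contDiff_smul_eq h.2.1 h'.2.1 fun φ hφ hc => ?_
  have := (h.2.2 φ hφ hc).symm.trans (h'.2.2 φ hφ hc)
  simpa [mul_comm] using this

theorem isWeakPartial_congr {j : Fin 3} {f f' g : R3 → ℝ} (h : IsWeakPartial j f g)
    (hf : f =ᵐ[volume] f') : IsWeakPartial j f' g := by
  refine ⟨h.1.congr hf, h.2.1, fun φ hφ hc => ?_⟩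
  rw [← h.2.2 φ hφ hc]
  refine integral_congr_ae ?_
  filter_upwards [hf] with x hx
  rw [hx]

theorem IsWeakPartial.add {j : Fin 3} {f g f' g' : R3 → ℝ} (h : IsWeakPartial j f g)
    (h' : IsWeakPartial j f' g') :
    IsWeakPartial j (fun x => f x + f' x) (fun x => g x + g' x) := by
  refine ⟨h.1.add h'.1, h.2.1.add h'.2.1, fun φ hφ hc => ?_⟩
  have hc' : HasCompactSupport fun x => fderiv ℝ φ x (EuclideanSpace.single j 1) :=
    hc.fderiv_apply (𝕜 := ℝ) _
  have hφ' : Continuous fun x => fderiv ℝ φ x (EuclideanSpace.single j 1) :=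
    (hφ.continuous_fderiv (by simp)).clm_apply continuous_const
  have i1 := h.1.integrable_smul_right_of_hasCompactSupport hφ' hc'
  have i2 := h'.1.integrable_smul_right_of_hasCompactSupport hφ' hc'
  have i3 := h.2.1.integrable_smul_right_of_hasCompactSupport hφ.continuous hc
  have i4 := h'.2.1.integrable_smul_right_of_hasCompactSupport hφ.continuous hc
  simp only [smul_eq_mul] at i1 i2 i3 i4
  simp only [add_mul]
  rw [integral_add i1 i2, integral_add i3 i4, h.2.2 φ hφ hc, h'.2.2 φ hφ hc]
  ring

theorem IsWeakPartial.neg {j : Fin 3} {f g : R3 → ℝ} (h : IsWeakPartial j f g) :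
    IsWeakPartial j (fun x => -f x) (fun x => -g x) := by
  refine ⟨h.1.neg, h.2.1.neg, fun φ hφ hc => ?_⟩
  simp only [neg_mul, integral_neg, h.2.2 φ hφ hc]

theorem IsWeakPartial.sub {j : Fin 3} {f g f' g' : R3 → ℝ} (h : IsWeakPartial j f g)
    (h' : IsWeakPartial j f' g') :
    IsWeakPartial j (fun x => f x - f' x) (fun x => g x - g' x) := by
  simpa [sub_eq_add_neg] using h.add h'.neg

/-! ### The transform of real functions -/

/-- Real square integrable functions as complex valued ones. -/
def toC : L2 →L[ℝ] Lp ℂ 2 (volume : Measure R3) := Complex.ofRealCLM.compLpL 2 volume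

theorem toC_ae (f : L2) : ∀ᵐ x, toC f x = (f x : ℂ) :=
  Complex.ofRealCLM.coeFn_compLp f

theorem hat_eq (f : L2) : hat f = 𝓕 (toC f) := rfl

theorem norm_toC (f : L2) : ‖toC f‖ = ‖f‖ := by
  refine le_antisymm (Lp.norm_le_norm_of_ae_le ?_) (Lp.norm_le_norm_of_ae_le ?_) <;>
  · filter_upwards [toC_ae f] with x hx
    simp [hx]

theorem norm_hat (f : L2) : ‖hat f‖ = ‖f‖ := by
  rw [hat_eq, Lp.norm_fourier_eq, norm_toC]

theorem hat_add (f g : L2) : hat (f + g) = hat f + hat g := by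
  simp only [hat_eq, map_add, FourierTransform.fourier_add]

theorem hat_smul (c : ℝ) (f : L2) : hat (c • f) = (c : ℂ) • hat f := by
  have : toC (c • f) = (c : ℂ) • toC f := by
    rw [map_smul]; rfl
  rw [hat_eq, this, FourierTransform.fourier_smul]; rfl

theorem fourierInv_hat (f : L2) : 𝓕⁻ (hat f) = toC f := by
  rw [hat_eq, FourierTransform.fourierInv_fourier_eq]

/-- Inversion for square integrable functions with integrable transform. -/
theorem ae_eq_fourierInv_hat {f : L2} (hf : Integrable (hat f)) :
    ∀ᵐ x, (f x : ℂ) = 𝓕⁻ (hat f : R3 → ℂ) x := by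
  have := fourierInv_ae_eq hf
  rw [fourierInv_hat] at this
  filter_upwards [this, toC_ae f] with x h1 h2
  rw [← h2, h1]

theorem enorm_sq_L2 {E : Type*} [NormedAddCommGroup E] (f : Lp E 2 (volume : Measure R3)) :
    ‖f‖ₑ ^ 2 = ∫⁻ x, ‖f x‖ₑ ^ 2 := by
  rw [Lp.enorm_def, eLpNorm_eq_lintegral_rpow_enorm_toReal (by norm_num) (by norm_num),
    ← ENNReal.rpow_natCast, ← ENNReal.rpow_mul]
  simp

/-- A weak derivative of a function in `H¹` is the function with transform `2πi ξ_j f̂(ξ)`. -/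
theorem exists_weakPartial_hat {f : L2} {d : R3 → ℝ} {j : Fin 3} (h : IsWeakPartial j f d)
    (hf : MemLp (fun ξ => 2 * Real.pi * Complex.I * (ξ j : ℂ) * hat f ξ) 2 volume) :
    ∃ D : L2, d =ᵐ[volume] D ∧
      ∀ᵐ ξ, hat D ξ = 2 * Real.pi * Complex.I * (ξ j : ℂ) * hat f ξ := by
  -- The candidate derivative, a priori complex valued. It agrees with `d` against all test
  -- functions, so it is almost everywhere real and `d` is square integrable.
  set E : Lp ℂ 2 (volume : Measure R3) := 𝓕⁻ hf.toLp with hE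
  have hE' : 𝓕 E = hf.toLp := by rw [hE, FourierTransform.fourier_fourierInv_eq]
  have hdE : (fun x => (d x : ℂ)) =ᵐ[volume] E := by
    refine ae_eq_of_integral_contDiff_smul_eq ?_ (locallyIntegrable_L2 _) fun φ hφ hc => ?_
    · have := h.2.1
      intro x
      obtain ⟨U, hU, hi⟩ := this x
      exact ⟨U, hU, hi.ofReal⟩
    have hg₁ : HasCompactSupport (Complex.ofRealCLM ∘ φ) := hc.comp_left rfl
    have hg₂ : ContDiff ℝ ∞ (Complex.ofRealCLM ∘ φ) := by fun_prop
    have h1 := integral_lineDeriv_mul (f := toC f) (d := E) j ?_ (hg₁.toSchwartzMap hg₂)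
    · have h2 := congrArg (fun r : ℝ => (r : ℂ)) (h.2.2 φ hφ hc)
      simp only [Complex.ofReal_neg, ← integral_complex_ofReal] at h2
      have h3 : ∫ x, (LineDeriv.lineDerivOp (EuclideanSpace.single j (1 : ℝ))
          (hg₁.toSchwartzMap hg₂)) x * toC f x =
          ∫ x, ((f x * fderiv ℝ φ x (EuclideanSpace.single j 1) : ℝ) : ℂ) := by
        refine integral_congr_ae ?_
        filter_upwards [toC_ae f] with x hx
        rw [hx, SchwartzMap.lineDerivOp_apply_eq_fderiv]
        have : HasFDerivAt (hg₁.toSchwartzMap hg₂) (Complex.ofRealCLM ∘L fderiv ℝ φ x) x :=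
          Complex.ofRealCLM.hasFDerivAt.comp x
            ((hφ.differentiable (by simp)).differentiableAt.hasFDerivAt)
        rw [this.fderiv]
        simp [mul_comm]
      rw [h3, h2, neg_inj] at h1
      simp only [Complex.real_smul, Complex.ofReal_mul] at h1 ⊢
      simp only [HasCompactSupport.toSchwartzMap_toFun, Function.comp_apply,
        Complex.ofRealCLM_apply] at h1
      rw [← h1]
      congr 1
      ext x
      ring
    · rw [hE']
      filter_upwards [hf.coeFn_toLp] with ξ hξ
      rw [hξ, hat_eq]
  have hd2 : MemLp d 2 volume := by
    have : MemLp (fun x => (d x : ℂ)) 2 volume := (memLp_congr_ae hdE).2 (Lp.memLp E)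
    simpa using this.re
  refine ⟨hd2.toLp, hd2.coeFn_toLp.symm, ?_⟩
  have : toC hd2.toLp = E := by
    refine Lp.ext ?_
    filter_upwards [toC_ae hd2.toLp, hdE, hd2.coeFn_toLp] with x h1 h2 h3
    rw [h1, h3, ← h2]
  rw [hat_eq, this, hE']
  exact hf.coeFn_toLp

/-! ### Differentiating inverse Fourier integrals -/

/-- Differentiation under the integral sign, dominated by the first moment of `f`. -/
theorem hasFDerivAt_fourierInv {f : R3 → ℂ} (hf : Integrable f)
    (hf' : Integrable fun ξ => (‖ξ‖ : ℂ) * f ξ) (x : R3) :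
    ∃ A : R3 →L[ℝ] ℂ, HasFDerivAt (𝓕⁻ f) A x ∧ ∀ j, A (EuclideanSpace.single j 1) =
      𝓕⁻ (fun ξ : R3 => 2 * Real.pi * Complex.I * (ξ j : ℂ) * f ξ) x := by
  have hf'' : Integrable fun ξ : R3 => ‖ξ‖ * ‖f ξ‖ := by
    simpa using hf'.norm
  refine ⟨_, VectorFourier.hasFDerivAt_fourierIntegral (-innerSL ℝ) hf hf'' x, fun j => ?_⟩
  rw [Real.fourierIntegral_continuousLinearMap_apply' (L := -innerSL ℝ)]
  · change VectorFourier.fourierIntegral _ _ (-innerₗ R3) _ _ = VectorFourier.fourierIntegral _ _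
      (-innerₗ R3) _ _
    congr 1
    ext ξ
    simp [VectorFourier.fourierSMulRight, innerSL_apply_apply ℝ, EuclideanSpace.inner_single_right]
    ring
  · refine (hf''.const_mul (2 * Real.pi * ‖(-innerSL ℝ : R3 →L[ℝ] R3 →L[ℝ] ℝ)‖)).mono'
      hf.1.fourierSMulRight (Eventually.of_forall fun ξ => ?_)
    refine (VectorFourier.norm_fourierSMulRight_le _ _ _).trans_eq ?_
    ring

theorem integrable_coord_mul {f : R3 → ℂ} (hf : AEStronglyMeasurable f)
    (hf' : Integrable fun ξ => (‖ξ‖ : ℂ) * f ξ) (j : Fin 3) :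
    Integrable fun ξ : R3 => 2 * Real.pi * Complex.I * (ξ j : ℂ) * f ξ := by
  refine (hf'.const_mul (2 * Real.pi : ℂ)).mono (AEStronglyMeasurable.mul (by fun_prop) hf)
    (Eventually.of_forall fun ξ => ?_)
  simp only [norm_mul, Complex.norm_real, Complex.norm_I, mul_one, norm_norm]
  have := PiLp.norm_apply_le ξ j
  rw [← mul_assoc]
  gcongr

/-- A continuously differentiable inverse Fourier integral has its classical partial derivatives
as weak partial derivatives. -/
theorem isWeakPartial_of_fourierInv {f : R3 → ℂ} (hf : Integrable f)
    (hf' : Integrable fun ξ => (‖ξ‖ : ℂ) * f ξ) {u : R3 → ℝ} (hu : ∀ x, (u x : ℂ) = 𝓕⁻ f x)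
    (j : Fin 3) :
    IsWeakPartial j u
      fun x => (𝓕⁻ (fun ξ : R3 => 2 * Real.pi * Complex.I * (ξ j : ℂ) * f ξ) x).re := by
  have hu' : u = fun x => (𝓕⁻ f x).re := by
    ext x; rw [← hu]; simp
  have hc : Continuous u := by
    rw [hu']
    exact Complex.continuous_re.comp (continuous_fourierInv_of_integrable hf)
  have hc' := Complex.continuous_re.comp
    (continuous_fourierInv_of_integrable (integrable_coord_mul hf.1 hf' j))
  have hd : ∀ x, ∃ A : R3 →L[ℝ] ℝ, HasFDerivAt u A x ∧ A (EuclideanSpace.single j 1) =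
      (𝓕⁻ (fun ξ : R3 => 2 * Real.pi * Complex.I * (ξ j : ℂ) * f ξ) x).re := by
    intro x
    obtain ⟨A, hA, hA'⟩ := hasFDerivAt_fourierInv hf hf' x
    refine ⟨Complex.reCLM ∘L A, ?_, ?_⟩
    · rw [hu']
      exact Complex.reCLM.hasFDerivAt.comp x hA
    · simp [hA']
  have hd' : ∀ x, fderiv ℝ u x (EuclideanSpace.single j 1) =
      (𝓕⁻ (fun ξ : R3 => 2 * Real.pi * Complex.I * (ξ j : ℂ) * f ξ) x).re := by
    intro x
    obtain ⟨A, hA, hA'⟩ := hd x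
    rw [hA.fderiv, hA']
  refine ⟨hc.locallyIntegrable, hc'.locallyIntegrable, fun φ hφ hφc => ?_⟩
  have hφ' : Continuous fun x => fderiv ℝ φ x (EuclideanSpace.single j 1) :=
    (hφ.continuous_fderiv (by simp)).clm_apply continuous_const
  rw [integral_mul_fderiv_eq_neg_fderiv_mul_of_integrable]
  · simp only [hd']
  · simp only [hd']
    exact (hc'.mul hφ.continuous).integrable_of_hasCompactSupport hφc.mul_left
  · exact (hc.mul hφ').integrable_of_hasCompactSupport (hφc.fderiv_apply (𝕜 := ℝ) _).mul_left
  · exact (hc.mul hφ.continuous).integrable_of_hasCompactSupport hφc.mul_left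
  · intro x _
    obtain ⟨A, hA, -⟩ := hd x
    exact hA.differentiableAt
  · intro x _
    exact (hφ.differentiable (by simp)).differentiableAt

/-! ### Power weights -/

/-- The square of the Japanese bracket. -/
def jb (ξ : R3) : ℝ := 1 + 4 * Real.pi ^ 2 * ‖ξ‖ ^ 2

theorem one_le_jb (ξ : R3) : 1 ≤ jb ξ := by
  have : 0 ≤ 4 * Real.pi ^ 2 * ‖ξ‖ ^ 2 := by positivity
  unfold jb; linarith

theorem jb_pos (ξ : R3) : 0 < jb ξ := zero_lt_one.trans_le (one_le_jb ξ)

@[fun_prop]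
theorem continuous_jb : Continuous jb := by unfold jb; fun_prop

theorem one_add_sq_le_jb (ξ : R3) : 1 + ‖ξ‖ ^ 2 ≤ jb ξ := by
  have : 1 ≤ 4 * Real.pi ^ 2 := by nlinarith [Real.pi_gt_three]
  unfold jb
  nlinarith [sq_nonneg ‖ξ‖]

theorem measurable_jb_rpow (s : ℝ) : Measurable fun ξ => jb ξ ^ s :=
  continuous_jb.measurable.pow_const s

theorem finrank_R3 : Module.finrank ℝ R3 = 3 := by simp

/-- In polar coordinates the Jacobian y² cancels y⁻², leaving a constant on (0, 1). -/
theorem integrableOn_norm_rpow_neg_two :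
    IntegrableOn (fun z : R3 => ‖z‖ ^ (-2 : ℝ)) (Metric.ball 0 1) := by
  refine (integrableOn_fun_norm_addHaar volume (f := fun y : ℝ => y ^ (-2 : ℝ))).2 ?_
  have : IntegrableOn (fun _ : ℝ => (1 : ℝ)) (Ioo 0 1) := by simp
  refine this.congr_fun (fun y hy => ?_) measurableSet_Ioo
  have hy0 : 0 < y := hy.1
  simp only [finrank_R3, smul_eq_mul]
  rw [← Real.rpow_natCast, ← Real.rpow_add hy0]
  norm_num

theorem integrableOn_norm_rpow_compl_ball {r : ℝ} (hr : 3 < r) :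
    IntegrableOn (fun z : R3 => ‖z‖ ^ (-r)) (Metric.ball 0 1)ᶜ := by
  have h := (integrable_one_add_norm (E := R3) (μ := volume) (r := r)
    (by rw [finrank_R3]; exact_mod_cast hr)).const_mul ((2 : ℝ) ^ r)
  refine (h.integrableOn (s := (Metric.ball 0 1)ᶜ)).mono' ?_ ?_
  · exact (measurable_norm.pow_const _).aestronglyMeasurable
  · refine (ae_restrict_iff' Metric.isOpen_ball.measurableSet.compl).2 (Eventually.of_forall ?_)
    intro z hz
    have hz1 : 1 ≤ ‖z‖ := by simpa using hz
    have hz0 : 0 < ‖z‖ := by linarith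
    rw [Real.norm_of_nonneg (by positivity)]
    calc ‖z‖ ^ (-r) = 2 ^ r * (2 * ‖z‖) ^ (-r) := by
          rw [Real.mul_rpow (by norm_num) hz0.le, ← mul_assoc, ← Real.rpow_add (by norm_num)]
          simp
      _ ≤ 2 ^ r * (1 + ‖z‖) ^ (-r) := by
          refine mul_le_mul_of_nonneg_left ?_ (by positivity)
          exact Real.rpow_le_rpow_of_nonpos (by positivity) (by linarith) (by linarith)

theorem integrable_jb_rpow {s : ℝ} (hs : 3 / 2 < s) : Integrable fun ξ => jb ξ ^ (-s) := by
  have h := integrable_rpow_neg_one_add_norm_sq (E := R3) (μ := volume) (r := 2 * s)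
    (by rw [finrank_R3]; push_cast; linarith)
  refine h.mono' (measurable_jb_rpow _).aestronglyMeasurable (Eventually.of_forall fun ξ => ?_)
  rw [Real.norm_of_nonneg (Real.rpow_nonneg (jb_pos ξ).le _), show -(2 * s) / 2 = -s by ring]
  exact Real.rpow_le_rpow_of_nonpos (by positivity) (one_add_sq_le_jb ξ) (by linarith)

/-- A uniform bound for the convolution of `|·|⁻²` and a power of the Japanese bracket. -/
theorem exists_convolution_bound {s : ℝ} (hs : 3 / 2 < s) :
    ∃ K : ℝ≥0∞, K < ⊤ ∧ ∀ ζ : R3,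
      ∫⁻ η : R3, ENNReal.ofReal ((‖η - ζ‖ ^ 2 * jb η ^ (s - 1))⁻¹) ≤ K := by
  -- For |η - ζ| < 1 the bracket is dropped and |z|⁻² is locally integrable. Elsewhere the integrand
  -- is at most |η - ζ|^{-2s} + jb(η)^{-s}, and both are integrable there since 2s > 3. None of the
  -- three pieces depends on ζ.
  refine ⟨(∫⁻ z in Metric.ball (0 : R3) 1, ENNReal.ofReal (‖z‖ ^ (-2 : ℝ))) +
    (∫⁻ z in (Metric.ball (0 : R3) 1)ᶜ, ENNReal.ofReal (‖z‖ ^ (-(2 * s)))) +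
    ∫⁻ η : R3, ENNReal.ofReal (jb η ^ (-s)), ?_, fun ζ => ?_⟩
  · refine ENNReal.add_lt_top.2 ⟨ENNReal.add_lt_top.2 ⟨?_, ?_⟩, ?_⟩
    · exact integrableOn_norm_rpow_neg_two.lintegral_lt_top
    · exact (integrableOn_norm_rpow_compl_ball (by linarith)).lintegral_lt_top
    · exact (integrable_jb_rpow hs).lintegral_lt_top
  · have hm : ∀ (r : ℝ) (S : Set R3), MeasurableSet S → Measurable fun η =>
        S.indicator (fun z : R3 => ENNReal.ofReal (‖z‖ ^ r)) (η - ζ) := fun r S hS =>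
      ((measurable_norm.pow_const r).ennreal_ofReal.indicator hS).comp (measurable_sub_const ζ)
    rw [← lintegral_indicator Metric.isOpen_ball.measurableSet,
      ← lintegral_indicator Metric.isOpen_ball.measurableSet.compl,
      ← lintegral_sub_right_eq_self (fun z : R3 => (Metric.ball (0 : R3) 1).indicator _ z) ζ,
      ← lintegral_sub_right_eq_self (fun z : R3 => (Metric.ball (0 : R3) 1)ᶜ.indicator _ z) ζ,
      ← lintegral_add_left, ← lintegral_add_left]
    · refine lintegral_mono fun η => ?_
      have hj := one_le_jb η
      have hj0 := jb_pos η
      by_cases hη : η - ζ ∈ Metric.ball (0 : R3) 1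
      · rw [indicator_of_mem hη, add_assoc]
        refine le_add_right (ENNReal.ofReal_le_ofReal ?_)
        rw [Real.rpow_neg (norm_nonneg _), Real.rpow_two, mul_inv]
        exact mul_le_of_le_one_right (by positivity)
          (inv_le_one_of_one_le₀ (Real.one_le_rpow hj (by linarith)))
      · have hη' : η - ζ ∈ (Metric.ball (0 : R3) 1)ᶜ := hη
        rw [indicator_of_mem hη', indicator_of_notMem hη, zero_add,
          ← ENNReal.ofReal_add (by positivity) (by positivity)]
        refine ENNReal.ofReal_le_ofReal ?_
        have hn : 1 ≤ ‖η - ζ‖ := by simpa using hη'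
        have hn0 : 0 < ‖η - ζ‖ := by linarith
        rw [← Real.rpow_two, mul_inv, ← Real.rpow_neg hn0.le, ← Real.rpow_neg hj0.le]
        have e2 : ‖η - ζ‖ ^ (-(2 * s)) = (‖η - ζ‖ ^ (2:ℝ)) ^ (-s) := by
          rw [← Real.rpow_mul hn0.le]; ring_nf
        have e1 : ‖η - ζ‖ ^ (-2 : ℝ) = (‖η - ζ‖ ^ (2:ℝ)) ^ (-1 : ℝ) := by
          rw [← Real.rpow_mul hn0.le]; ring_nf
        rw [e1, e2]
        have ha : 0 < ‖η - ζ‖ ^ (2:ℝ) := by positivity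
        set a := ‖η - ζ‖ ^ (2:ℝ)
        set b := jb η
        -- Both exponents are negative, so replacing the larger of a, b by the smaller one increases
        -- the product to min(a, b)^{-s}.
        rcases le_total a b with hab | hab
        · calc a ^ (-1 : ℝ) * b ^ (-(s - 1)) ≤ a ^ (-1 : ℝ) * a ^ (-(s - 1)) := by
                gcongr 1
                exact Real.rpow_le_rpow_of_nonpos ha hab (by linarith)
            _ = a ^ (-s) := by rw [← Real.rpow_add ha]; ring_nf
            _ ≤ _ := le_add_of_nonneg_right (by positivity)
        · calc a ^ (-1 : ℝ) * b ^ (-(s - 1)) ≤ b ^ (-1 : ℝ) * b ^ (-(s - 1)) := by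
                gcongr 1
                exact Real.rpow_le_rpow_of_nonpos hj0 hab (by linarith)
            _ = b ^ (-s) := by rw [← Real.rpow_add hj0]; ring_nf
            _ ≤ _ := le_add_of_nonneg_left (by positivity)
    · exact (hm _ _ Metric.isOpen_ball.measurableSet).add
        (hm _ _ Metric.isOpen_ball.measurableSet.compl)
    · exact hm _ _ Metric.isOpen_ball.measurableSet

theorem lintegral_mul_sq_le {α : Type*} [MeasurableSpace α] {μ : Measure α} {f g : α → ℝ≥0∞}
    (hf : AEMeasurable f μ) (hg : AEMeasurable g μ) :
    (∫⁻ a, f a * g a ∂μ) ^ 2 ≤ (∫⁻ a, f a ^ 2 ∂μ) * ∫⁻ a, g a ^ 2 ∂μ := by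
  have h := ENNReal.lintegral_mul_le_Lp_mul_Lq μ Real.HolderConjugate.two_two hf hg
  have h2 := pow_le_pow_left' h 2
  rw [mul_pow, ← ENNReal.rpow_natCast, ← ENNReal.rpow_natCast, ← ENNReal.rpow_natCast,
    ← ENNReal.rpow_mul, ← ENNReal.rpow_mul] at h2
  simpa using h2

/-- The weighted Cauchy-Schwarz inequality. -/
theorem lintegral_mul_sq_le_weight {α : Type*} [MeasurableSpace α] {μ : Measure α}
    {f g : α → ℝ≥0∞} (hf : AEMeasurable f μ) (hg : AEMeasurable g μ) {W : α → ℝ}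
    (hW : Measurable W) (hW0 : ∀ᵐ a ∂μ, 0 < W a) :
    (∫⁻ a, f a * g a ∂μ) ^ 2 ≤
      (∫⁻ a, ENNReal.ofReal (W a) * f a ^ 2 ∂μ) * ∫⁻ a, ENNReal.ofReal (W a)⁻¹ * g a ^ 2 ∂μ := by
  have h := lintegral_mul_sq_le (μ := μ)
    (f := fun a => ENNReal.ofReal (W a) ^ (1 / 2 : ℝ) * f a)
    (g := fun a => ENNReal.ofReal (W a)⁻¹ ^ (1 / 2 : ℝ) * g a)
    ((hW.ennreal_ofReal.pow_const _).aemeasurable.mul hf)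
    ((hW.inv.ennreal_ofReal.pow_const _).aemeasurable.mul hg)
  have e : ∀ x : ℝ≥0∞, (x ^ (1 / 2 : ℝ)) ^ 2 = x := fun x => by
    rw [← ENNReal.rpow_natCast, ← ENNReal.rpow_mul]; simp
  simp only [mul_pow, e] at h
  refine le_trans (le_of_eq ?_) h
  congr 1
  refine lintegral_congr_ae ?_
  filter_upwards [hW0] with a ha
  have : ENNReal.ofReal (W a) ^ (1 / 2 : ℝ) * ENNReal.ofReal (W a)⁻¹ ^ (1 / 2 : ℝ) = 1 := by
    rw [← ENNReal.mul_rpow_of_nonneg _ _ (by norm_num), ← ENNReal.ofReal_mul ha.le,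
      mul_inv_cancel₀ ha.ne']
    simp
  calc f a * g a = 1 * (f a * g a) := (one_mul _).symm
    _ = _ := by rw [← this]; ring

/-- The product estimate `Ḣ¹ · H^{s-1} ⊂ L²` in dual form on the Fourier side. -/
theorem exists_trilinear_bound {s : ℝ} (hs : 3 / 2 < s) :
    ∃ K : ℝ≥0∞, K < ⊤ ∧ ∀ A B C : R3 → ℝ≥0∞, Measurable A → Measurable B → Measurable C →
      (∫⁻ ξ, ∫⁻ η, A ξ * B η * C (η - ξ)) ^ 2 ≤
        K * (∫⁻ ξ, ENNReal.ofReal (‖ξ‖ ^ 2) * A ξ ^ 2) *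
          (∫⁻ η, ENNReal.ofReal (jb η ^ (s - 1)) * B η ^ 2) * ∫⁻ ζ, C ζ ^ 2 := by
  obtain ⟨K, hK, hb⟩ := exists_convolution_bound hs
  refine ⟨K, hK, fun A B C hA hB hC => ?_⟩
  have hC' : Measurable fun p : R3 × R3 => C (p.2 - p.1) := hC.comp (by fun_prop)
  have hAB : Measurable fun p : R3 × R3 => A p.1 * B p.2 := by fun_prop
  have hW : Measurable fun p : R3 × R3 => ‖p.1‖ ^ 2 * jb p.2 ^ (s - 1) :=
    (by fun_prop : Measurable fun p : R3 × R3 => ‖p.1‖ ^ 2).mul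
      ((measurable_jb_rpow (s - 1)).comp measurable_snd)
  rw [← lintegral_prod (μ := volume) (ν := volume)
    (fun p : R3 × R3 => A p.1 * B p.2 * C (p.2 - p.1))
    (hAB.mul hC').aemeasurable]
  -- With the weight |ξ|² jb(η)^{s-1} one factor splits into the integrals of A and B, and the other
  -- becomes, after ζ = η - ξ, the integral bounded by `exists_convolution_bound`. The weight
  -- vanishes only on the null set ξ = 0.
  refine (lintegral_mul_sq_le_weight hAB.aemeasurable hC'.aemeasurable hW ?_).trans ?_
  · have : ∀ᵐ p : R3 × R3 ∂(volume.prod volume), p.1 ≠ 0 :=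
      Measure.quasiMeasurePreserving_fst.ae (Measure.ae_ne volume 0)
    filter_upwards [this] with p hp
    have := jb_pos p.2
    have := norm_pos_iff.2 hp
    positivity
  · have e1 : ∫⁻ p : R3 × R3, ENNReal.ofReal (‖p.1‖ ^ 2 * jb p.2 ^ (s - 1)) * (A p.1 * B p.2) ^ 2
          ∂(volume.prod volume) =
        (∫⁻ ξ, ENNReal.ofReal (‖ξ‖ ^ 2) * A ξ ^ 2) *
          ∫⁻ η, ENNReal.ofReal (jb η ^ (s - 1)) * B η ^ 2 := by
      rw [← lintegral_prod_mul]
      · refine lintegral_congr fun p => ?_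
        rw [ENNReal.ofReal_mul (by positivity), mul_pow]
        ring
      · fun_prop
      · exact ((measurable_jb_rpow (s - 1)).ennreal_ofReal.mul (hB.pow_const 2)).aemeasurable
    have e2 : ∫⁻ p : R3 × R3, ENNReal.ofReal (‖p.1‖ ^ 2 * jb p.2 ^ (s - 1))⁻¹ * C (p.2 - p.1) ^ 2
          ∂(volume.prod volume) ≤ K * ∫⁻ ζ, C ζ ^ 2 := by
      have hm : Measurable fun p : R3 × R3 =>
          ENNReal.ofReal (‖p.1‖ ^ 2 * jb p.2 ^ (s - 1))⁻¹ * C (p.2 - p.1) ^ 2 :=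
        hW.inv.ennreal_ofReal.mul (hC'.pow_const 2)
      rw [lintegral_prod_symm _ hm.aemeasurable]
      have : ∀ η : R3, ∫⁻ ξ, ENNReal.ofReal (‖ξ‖ ^ 2 * jb η ^ (s - 1))⁻¹ * C (η - ξ) ^ 2 =
          ∫⁻ ζ, ENNReal.ofReal (‖η - ζ‖ ^ 2 * jb η ^ (s - 1))⁻¹ * C ζ ^ 2 := fun η => by
        rw [← lintegral_sub_left_eq_self _ η]
        simp
      simp only [this]
      rw [lintegral_lintegral_swap]
      · rw [← lintegral_const_mul _ (hC.pow_const 2)]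
        refine lintegral_mono fun ζ => ?_
        rw [lintegral_mul_const]
        · gcongr
          exact hb ζ
        · exact Measurable.ennreal_ofReal
            (((by fun_prop : Measurable fun η : R3 => ‖η - ζ‖ ^ 2).mul (measurable_jb_rpow _)).inv)
      · have h1 : Measurable fun p : R3 × R3 => ‖p.1 - p.2‖ ^ 2 * jb p.1 ^ (s - 1) :=
          (by fun_prop : Measurable fun p : R3 × R3 => ‖p.1 - p.2‖ ^ 2).mul
            ((measurable_jb_rpow (s - 1)).comp measurable_fst)
        exact (h1.inv.ennreal_ofReal.mul ((hC.comp measurable_snd).pow_const 2)).aemeasurable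
    rw [e1]
    calc _ ≤ _ := mul_le_mul_right e2 _
      _ = _ := by ring

/-! ### Sobolev norms -/

theorem hsNorm_sq (s : ℝ) (f : L2) :
    hsNorm s f ^ 2 = ∫⁻ ξ, ENNReal.ofReal (jb ξ ^ s) * ‖hat f ξ‖ₑ ^ 2 := by
  rw [hsNorm, ← ENNReal.rpow_natCast, ← ENNReal.rpow_mul]
  simp [jb]

theorem measurable_hat (f : L2) : Measurable fun ξ => ‖hat f ξ‖ₑ :=
  (Lp.stronglyMeasurable _).enorm

theorem hsNorm_mono {s s' : ℝ} (h : s ≤ s') (f : L2) : hsNorm s f ≤ hsNorm s' f := by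
  refine ENNReal.rpow_le_rpow (lintegral_mono fun ξ => ?_) (by norm_num)
  gcongr
  exact one_le_jb ξ

theorem hsNorm_zero (f : L2) : hsNorm 0 f = ‖f‖ₑ := by
  have h : hsNorm 0 f ^ 2 = ‖f‖ₑ ^ 2 := by
    rw [hsNorm_sq, ← enorm_norm f, ← norm_hat, enorm_norm, enorm_sq_L2]
    simp
  exact (ENNReal.pow_right_strictMono two_ne_zero).injective h

theorem enorm_le_hsNorm {s : ℝ} (hs : 0 ≤ s) (f : L2) : ‖f‖ₑ ≤ hsNorm s f :=
  (hsNorm_zero f).symm.trans_le (hsNorm_mono hs f)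

theorem hsNorm_le_hsDotNorm (s : ℝ) (f : L2) : hsNorm s f ≤ hsDotNorm s f := by
  refine ENNReal.rpow_le_rpow (lintegral_mono_ae ?_) (by norm_num)
  filter_upwards [Measure.ae_ne volume (0 : R3)] with ξ hξ
  gcongr
  have h1 : 0 < 4 * Real.pi ^ 2 * ‖ξ‖ ^ 2 := by
    have := norm_pos_iff.2 hξ
    positivity
  rw [le_div_iff₀ h1, Real.rpow_add (by positivity), Real.rpow_one]
  gcongr
  linarith

/-- Minkowski's inequality in L² for the functions jb^{s/2} |f̂|. -/
theorem hsNorm_add_le (s : ℝ) (f g : L2) : hsNorm s (f + g) ≤ hsNorm s f + hsNorm s g := by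
  have key : ∀ f : L2, hsNorm s f = (∫⁻ ξ, (ENNReal.ofReal (jb ξ ^ s) ^ (1 / 2 : ℝ) *
      ‖hat f ξ‖ₑ) ^ (2 : ℝ)) ^ (1 / 2 : ℝ) := fun f => by
    rw [hsNorm]
    congr 2
    ext ξ
    rw [ENNReal.mul_rpow_of_nonneg _ _ (by norm_num), ← ENNReal.rpow_mul]
    simp [jb]
  have hm : ∀ f : L2, Measurable fun ξ => ENNReal.ofReal (jb ξ ^ s) ^ (1 / 2 : ℝ) * ‖hat f ξ‖ₑ :=
    fun f => ((measurable_jb_rpow s).ennreal_ofReal.pow_const _).mul (measurable_hat f)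
  rw [key (f + g), key f, key g]
  refine le_trans (ENNReal.rpow_le_rpow (lintegral_mono_ae ?_) (by norm_num))
    (ENNReal.lintegral_Lp_add_le (hm f).aemeasurable (hm g).aemeasurable (by norm_num))
  rw [hat_add]
  filter_upwards [Lp.coeFn_add (hat f) (hat g)] with ξ hξ
  simp only [hξ, Pi.add_apply]
  refine ENNReal.rpow_le_rpow ?_ (by norm_num)
  rw [← mul_add]
  gcongr
  exact enorm_add_le _ _

theorem hsNorm_neg (s : ℝ) (f : L2) : hsNorm s (-f) = hsNorm s f := by
  unfold hsNorm
  congr 1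
  refine lintegral_congr_ae ?_
  have : hat (-f) = -hat f := by
    have := hat_smul (-1) f
    simpa using this
  rw [this]
  filter_upwards [Lp.coeFn_neg (hat f)] with ξ hξ
  simp only [hξ, Pi.neg_apply, enorm_neg]

theorem hsNorm_sub_le (s : ℝ) (f g : L2) : hsNorm s (f - g) ≤ hsNorm s f + hsNorm s g := by
  rw [sub_eq_add_neg, ← hsNorm_neg s g]
  exact hsNorm_add_le s f (-g)

/-- The transform of an `H^s` function is integrable for `s > 3/2`. -/
theorem exists_lintegral_hat_bound {s : ℝ} (hs : 3 / 2 < s) :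
    ∃ K : ℝ≥0∞, K < ⊤ ∧ ∀ f : L2, ∫⁻ ξ, ‖hat f ξ‖ₑ ≤ K * hsNorm s f := by
  -- Cauchy-Schwarz with weight jb^s leaves the square root of ∫ jb^{-s}, finite because 2s > 3.
  refine ⟨(∫⁻ ξ, ENNReal.ofReal (jb ξ ^ (-s))) ^ (1 / 2 : ℝ),
    ENNReal.rpow_lt_top_of_nonneg (by norm_num) (integrable_jb_rpow hs).lintegral_lt_top.ne,
    fun f => ?_⟩
  have h := lintegral_mul_sq_le_weight (μ := (volume : Measure R3)) (f := fun ξ => ‖hat f ξ‖ₑ)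
    (g := fun _ => 1) (measurable_hat f).aemeasurable aemeasurable_const (measurable_jb_rpow s)
    (Eventually.of_forall fun ξ => Real.rpow_pos_of_pos (jb_pos ξ) s)
  rw [← hsNorm_sq, mul_comm] at h
  simp only [mul_one, one_pow, ← Real.rpow_neg (jb_pos _).le] at h
  refine (ENNReal.pow_right_strictMono two_ne_zero).le_iff_le.1 (h.trans_eq ?_)
  rw [mul_pow, ← ENNReal.rpow_natCast (_ ^ _), ← ENNReal.rpow_mul]
  simp

/-! ### The Biot-Savart kernel and its Fourier multiplier -/

/-- The components of the Biot-Savart kernel `z / (4π|z|³)`. -/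
def bsKernel (l : Fin 3) (z : R3) : ℝ := z l / (4 * Real.pi * ‖z‖ ^ 3)

/-- The Fourier transform `-iξ_l / (2π|ξ|²)` of the Biot-Savart kernel. -/
def bsMul (l : Fin 3) (ξ : R3) : ℂ := -Complex.I * (ξ l : ℂ) / (2 * Real.pi * ‖ξ‖ ^ 2 : ℝ)

/-- A Gamma integral with Γ(3/2) = √π/2; it exhibits |z|⁻³ as a positive superposition of Gaussians.
-/
theorem integral_gaussian_kernel {z : R3} (hz : z ≠ 0) :
    IntegrableOn (fun t : ℝ => t ^ (1 / 2 : ℝ) * Real.exp (-(Real.pi * ‖z‖ ^ 2 * t))) (Ioi 0) ∧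
    ∫ t in Ioi (0 : ℝ), t ^ (1 / 2 : ℝ) * Real.exp (-(Real.pi * ‖z‖ ^ 2 * t)) =
      1 / (2 * Real.pi * ‖z‖ ^ 3) := by
  have hz0 := norm_pos_iff.2 hz
  have hr : 0 < Real.pi * ‖z‖ ^ 2 := by positivity
  have h := Real.integral_rpow_mul_exp_neg_mul_Ioi (a := 3 / 2) (r := Real.pi * ‖z‖ ^ 2)
    (by norm_num) hr
  have hG : Real.Gamma (3 / 2) = Real.sqrt Real.pi / 2 := by
    rw [show (3 / 2 : ℝ) = 1 / 2 + 1 by norm_num, Real.Gamma_add_one (by norm_num),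
      Real.Gamma_one_half_eq]
    ring
  have e : (1 / (Real.pi * ‖z‖ ^ 2)) ^ (3 / 2 : ℝ) * (Real.sqrt Real.pi / 2) =
      1 / (2 * Real.pi * ‖z‖ ^ 3) := by
    have hp : (1 / (Real.pi * ‖z‖ ^ 2)) ^ (3 / 2 : ℝ) =
        1 / (Real.pi * Real.sqrt Real.pi * ‖z‖ ^ 3) := by
      rw [Real.div_rpow (by norm_num) hr.le, Real.one_rpow,
        Real.mul_rpow Real.pi_pos.le (by positivity), ← Real.rpow_natCast ‖z‖ 2,
        ← Real.rpow_mul hz0.le, show (3 / 2 : ℝ) = 1 + 1 / 2 by norm_num,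
        Real.rpow_add Real.pi_pos, Real.sqrt_eq_rpow, Real.rpow_one]
      norm_num
    rw [hp]
    have := Real.sqrt_pos.2 Real.pi_pos
    field_simp
  rw [show (3 / 2 - 1 : ℝ) = 1 / 2 by norm_num, hG, e] at h
  refine ⟨?_, h⟩
  -- The integral of a non-integrable function is 0 by convention, whereas the value found is
  -- positive.
  by_contra hc
  rw [integral_undef hc] at h
  have : 0 < 1 / (2 * Real.pi * ‖z‖ ^ 3) := by positivity
  linarith

/-- The substitution t ↦ 1/t reduces this to an exponential integral. It is the superposition of the
transformed Gaussians. -/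
theorem integral_gaussian_multiplier {ξ : R3} (hξ : ξ ≠ 0) :
    IntegrableOn (fun t : ℝ => t ^ (-2 : ℝ) * Real.exp (-(Real.pi * ‖ξ‖ ^ 2 * t ^ (-1 : ℝ))))
      (Ioi 0) ∧
    ∫ t in Ioi (0 : ℝ), t ^ (-2 : ℝ) * Real.exp (-(Real.pi * ‖ξ‖ ^ 2 * t ^ (-1 : ℝ))) =
      1 / (Real.pi * ‖ξ‖ ^ 2) := by
  have hz0 := norm_pos_iff.2 hξ
  have hr : 0 < Real.pi * ‖ξ‖ ^ 2 := by positivity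
  have h := integral_comp_rpow_Ioi (fun y => Real.exp (-(Real.pi * ‖ξ‖ ^ 2 * y))) (p := -1)
    (by norm_num)
  have h1 := Real.integral_rpow_mul_exp_neg_mul_Ioi (a := 1) one_pos hr
  simp only [sub_self, Real.rpow_zero, one_mul, Real.rpow_one, Real.Gamma_one, mul_one] at h1
  rw [h1] at h
  simp only [abs_neg, abs_one, one_mul, smul_eq_mul, show (-1 - 1 : ℝ) = -2 by norm_num] at h
  refine ⟨?_, h⟩
  by_contra hc
  rw [integral_undef hc] at h
  have : 0 < 1 / (Real.pi * ‖ξ‖ ^ 2) := by positivity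
  linarith

theorem integrable_gaussian {t : ℝ} (ht : 0 < t) :
    Integrable fun z : R3 => Complex.exp (-(Real.pi * t : ℝ) * (‖z‖ : ℂ) ^ 2) := by
  have := GaussianFourier.integrable_cexp_neg_mul_sq_norm_add (V := R3)
    (b := ((Real.pi * t : ℝ) : ℂ)) (by rw [Complex.ofReal_re]; positivity) 0 0
  simpa using this

theorem norm_gaussian (t : ℝ) (z : R3) :
    ‖Complex.exp (-(Real.pi * t : ℝ) * (‖z‖ : ℂ) ^ 2)‖ = Real.exp (-(Real.pi * t) * ‖z‖ ^ 2) := by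
  rw [Complex.norm_exp]
  congr 1
  rw [← Complex.ofReal_pow, ← Complex.ofReal_neg, ← Complex.ofReal_mul, Complex.ofReal_re]

theorem integrable_norm_mul_gaussian {t : ℝ} (ht : 0 < t) :
    Integrable fun z : R3 => (‖z‖ : ℂ) * Complex.exp (-(Real.pi * t : ℝ) * (‖z‖ : ℂ) ^ 2) := by
  refine ((integrable_gaussian (half_pos ht)).norm.const_mul (1 + 2 / (Real.pi * t))).mono'
    (by fun_prop) (Eventually.of_forall fun z => ?_)
  rw [norm_mul, norm_gaussian, norm_gaussian, Complex.norm_real, norm_norm]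
  have hb : 0 < Real.pi * t := by positivity
  set b := Real.pi * t
  have h1 : b / 2 * ‖z‖ ^ 2 + 1 ≤ Real.exp (b / 2 * ‖z‖ ^ 2) := Real.add_one_le_exp _
  have h2 : ‖z‖ ≤ (1 + 2 / b) * Real.exp (b / 2 * ‖z‖ ^ 2) := by
    have h3 : ‖z‖ ≤ 1 + ‖z‖ ^ 2 := by nlinarith [sq_nonneg (‖z‖ - 1)]
    have h4 : (1 + 2 / b) * (b / 2 * ‖z‖ ^ 2 + 1) =
        1 + ‖z‖ ^ 2 + (b / 2 * ‖z‖ ^ 2 + 2 / b) := by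
      field_simp
      ring
    have h5 : 0 ≤ b / 2 * ‖z‖ ^ 2 + 2 / b := by positivity
    have h6 : (1 + 2 / b) * (b / 2 * ‖z‖ ^ 2 + 1) ≤ (1 + 2 / b) * Real.exp (b / 2 * ‖z‖ ^ 2) := by
      gcongr
    linarith
  calc ‖z‖ * Real.exp (-b * ‖z‖ ^ 2)
      ≤ ((1 + 2 / b) * Real.exp (b / 2 * ‖z‖ ^ 2)) * Real.exp (-b * ‖z‖ ^ 2) := by gcongr
    _ = (1 + 2 / b) * Real.exp (-(Real.pi * (t / 2)) * ‖z‖ ^ 2) := by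
        rw [mul_assoc, ← Real.exp_add]
        congr 2
        simp only [b]
        ring

theorem fourierInv_gaussian {t : ℝ} (ht : 0 < t) (ξ : R3) :
    𝓕⁻ (fun z : R3 => Complex.exp (-(Real.pi * t : ℝ) * (‖z‖ : ℂ) ^ 2)) ξ =
      ((t ^ (-(3 / 2) : ℝ) * Real.exp (-(Real.pi * ‖ξ‖ ^ 2 * t⁻¹)) : ℝ) : ℂ) := by
  rw [Real.fourierInv_eq_fourier_neg, fourier_gaussian_innerProductSpace
    (by rw [Complex.ofReal_re]; positivity), norm_neg]
  have hpi := Real.pi_pos.ne'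
  rw [← Complex.ofReal_div, show Real.pi / (Real.pi * t) = t⁻¹ by field_simp, finrank_R3,
    show (((3 : ℕ) : ℂ) / 2) = ((3 / 2 : ℝ) : ℂ) by push_cast; rfl,
    ← Complex.ofReal_cpow (by positivity), Real.inv_rpow ht.le, ← Real.rpow_neg ht.le,
    Complex.ofReal_mul _ (Real.exp _), Complex.ofReal_exp]
  congr 2
  have : (Real.pi : ℂ) ≠ 0 := by exact_mod_cast hpi
  have : (t : ℂ) ≠ 0 := by exact_mod_cast ht.ne'
  push_cast
  field_simp

/-- Multiplication by 2πi z_l corresponds to ∂_l on the transform, so the transformed Gaussian is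
differentiated. -/
theorem fourierInv_coord_gaussian {t : ℝ} (ht : 0 < t) (l : Fin 3) (ξ : R3) :
    𝓕⁻ (fun z : R3 => (z l : ℂ) * Complex.exp (-(Real.pi * t : ℝ) * (‖z‖ : ℂ) ^ 2)) ξ =
      Complex.I * (ξ l : ℂ) *
        ((t ^ (-(5 / 2) : ℝ) * Real.exp (-(Real.pi * ‖ξ‖ ^ 2 * t⁻¹)) : ℝ) : ℂ) := by
  obtain ⟨A, hA, hA'⟩ := hasFDerivAt_fourierInv (integrable_gaussian ht)
    (integrable_norm_mul_gaussian ht) ξ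
  have h1 : HasFDerivAt (fun ξ : R3 => -(Real.pi * ‖ξ‖ ^ 2 * t⁻¹))
      (-(t⁻¹ • Real.pi • (2 • innerSL ℝ ξ))) ξ :=
    (((hasStrictFDerivAt_norm_sq ξ).hasFDerivAt.const_mul Real.pi).mul_const t⁻¹).neg
  have h2 := Complex.ofRealCLM.hasFDerivAt.comp ξ (h1.exp.const_mul (t ^ (-(3 / 2) : ℝ)))
  have h3 : A = _ := hA.unique (h2.congr_of_eventuallyEq
    (Eventually.of_forall fun η => fourierInv_gaussian ht η))
  have h4 := hA' l
  have h5 : 𝓕⁻ (fun z : R3 => 2 * Real.pi * Complex.I * (z l : ℂ) *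
      Complex.exp (-(Real.pi * t : ℝ) * (‖z‖ : ℂ) ^ 2)) ξ = 2 * Real.pi * Complex.I *
      𝓕⁻ (fun z : R3 => (z l : ℂ) * Complex.exp (-(Real.pi * t : ℝ) * (‖z‖ : ℂ) ^ 2)) ξ := by
    rw [Real.fourierInv_eq, Real.fourierInv_eq, ← integral_const_mul]
    congr 1
    ext z
    simp only [Circle.smul_def, smul_eq_mul]
    ring
  have hpi : (2 * Real.pi * Complex.I : ℂ) ≠ 0 := by
    simp [Real.pi_ne_zero]
  refine mul_left_cancel₀ hpi ?_
  rw [← h5, ← h4, h3]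
  have e : t ^ (-(5 / 2) : ℝ) = t ^ (-(3 / 2) : ℝ) * t⁻¹ := by
    rw [← Real.rpow_neg_one, ← Real.rpow_add ht]; norm_num
  rw [e]
  simp [innerSL_apply_apply ℝ, EuclideanSpace.inner_single_right]
  linear_combination (-2 * (Real.pi : ℂ) * (ξ l : ℂ) * ((t ^ (-(3 / 2) : ℝ) : ℝ) : ℂ) * (t : ℂ)⁻¹ *
    Complex.exp (-(Real.pi * (‖ξ‖ : ℂ) ^ 2 * (t : ℂ)⁻¹))) * Complex.I_sq

/-- Self-adjointness moves the inverse transform onto the Gaussian. The reflection y ↦ x - y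
produces the character at x and changes iξ_l into -iξ_l. -/
theorem integral_fourierInv_mul_gaussian {F : R3 → ℂ} (hF : Integrable F) {t : ℝ} (ht : 0 < t)
    (l : Fin 3) (x : R3) :
    ∫ y : R3, 𝓕⁻ F y * (((x - y) l : ℂ) * Complex.exp (-(Real.pi * t : ℝ) * (‖x - y‖ : ℂ) ^ 2)) =
      ∫ ξ : R3, F ξ * ((Real.fourierChar (inner ℝ ξ x) : ℂ) * (-Complex.I * (ξ l : ℂ) *
        ((t ^ (-(5 / 2) : ℝ) * Real.exp (-(Real.pi * ‖ξ‖ ^ 2 * t⁻¹)) : ℝ) : ℂ))) := by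
  have hg : Integrable fun z : R3 =>
      (z l : ℂ) * Complex.exp (-(Real.pi * t : ℝ) * (‖z‖ : ℂ) ^ 2) := by
    refine (integrable_norm_mul_gaussian ht).mono (by fun_prop) (Eventually.of_forall fun z => ?_)
    simp only [norm_mul, Complex.norm_real, norm_norm]
    gcongr
    exact PiLp.norm_apply_le z l
  have hg' := hg.comp_sub_left x
  rw [integral_fourierInv_mul hF hg']
  refine integral_congr_ae (Eventually.of_forall fun ξ => ?_)
  simp only
  congr 1
  rw [Real.fourierInv_eq, ← integral_sub_left_eq_self _ volume x]
  have h1 := fourierInv_coord_gaussian ht l (-ξ)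
  rw [Real.fourierInv_eq] at h1
  simp only [norm_neg, PiLp.neg_apply, Complex.ofReal_neg] at h1
  rw [neg_mul, ← mul_neg, ← h1, ← integral_const_mul]
  refine integral_congr_ae (Eventually.of_forall fun z => ?_)
  simp only [sub_sub_cancel, Circle.smul_def, smul_eq_mul]
  have e : (Real.fourierChar (inner ℝ (x - z) ξ) : ℂ) =
      (Real.fourierChar (inner ℝ ξ x) : ℂ) * (Real.fourierChar (inner ℝ z (-ξ)) : ℂ) := by
    rw [← Circle.coe_mul, ← AddChar.map_add_eq_mul, inner_sub_left, inner_neg_right,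
      real_inner_comm x ξ, sub_eq_add_neg]
  rw [e, mul_assoc]

/-- Fubini's theorem. As k ≥ 0, the iterated integral of the absolute value is ∫ ‖c‖ m, which `hi`
makes finite. -/
theorem integral_mul_integral_swap {c : R3 → ℂ} {k : R3 → ℝ → ℝ} {m : R3 → ℝ}
    (hc : AEStronglyMeasurable c) (hk : Measurable (Function.uncurry k))
    (hk0 : ∀ y t, 0 < t → 0 ≤ k y t)
    (hm : ∀ᵐ y, IntegrableOn (k y) (Ioi 0) ∧ ∫ t in Ioi (0 : ℝ), k y t = m y)
    (hi : Integrable fun y => ‖c y‖ * m y) :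
    ∫ y, c y * (m y : ℂ) = ∫ t in Ioi (0 : ℝ), ∫ y, c y * (k y t : ℂ) := by
  rw [← integral_integral_swap]
  · refine integral_congr_ae ?_
    filter_upwards [hm] with y hy
    rw [integral_const_mul, ← hy.2, integral_complex_ofReal]
  · have hmeas : AEStronglyMeasurable (Function.uncurry fun y t => c y * (k y t : ℂ))
        (volume.prod (volume.restrict (Ioi (0 : ℝ)))) :=
      hc.comp_fst.mul (Complex.measurable_ofReal.comp hk).aestronglyMeasurable
    rw [integrable_prod_iff hmeas]
    constructor
    · filter_upwards [hm] with y hy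
      exact hy.1.ofReal.const_mul (c y)
    · refine hi.congr ?_
      filter_upwards [hm] with y hy
      simp only [Function.uncurry_apply_pair, norm_mul, Complex.norm_real, integral_const_mul]
      rw [← hy.2]
      congr 1
      refine setIntegral_congr_fun measurableSet_Ioi fun t ht => ?_
      exact (Real.norm_of_nonneg (hk0 y t ht)).symm

/-- The Biot-Savart kernel acts as a Fourier multiplier. -/
theorem integral_bsKernel_mul_fourierInv {F : R3 → ℂ} (hF : Integrable F)
    (hF' : Integrable fun ξ => ‖F ξ‖ * ‖ξ‖⁻¹) (l : Fin 3) (x : R3)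
    (hx : Integrable fun y : R3 => ‖𝓕⁻ F y‖ * (‖x - y‖ ^ 2)⁻¹) :
    Integrable (fun y : R3 => (bsKernel l (x - y) : ℂ) * 𝓕⁻ F y) ∧
    ∫ y : R3, (bsKernel l (x - y) : ℂ) * 𝓕⁻ F y = 𝓕⁻ (fun ξ => bsMul l ξ * F ξ) x := by
  have hcF := continuous_fourierInv_of_integrable hF
  have hcoord : ∀ z : R3, |z l| ≤ ‖z‖ := fun z => PiLp.norm_apply_le z l
  have hb : ∀ z : R3, |z l| / (2 * (2 * Real.pi * ‖z‖ ^ 3)) ≤ (‖z‖ ^ 2)⁻¹ := fun z => by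
    rcases eq_or_ne z 0 with h0 | h0
    · simp [h0]
    · have := norm_pos_iff.2 h0
      rw [inv_eq_one_div, div_le_div_iff₀ (by positivity) (by positivity)]
      have : 1 ≤ 4 * Real.pi := by nlinarith [Real.pi_gt_three]
      calc |z l| * ‖z‖ ^ 2 ≤ ‖z‖ * ‖z‖ ^ 2 := by gcongr; exact hcoord z
        _ = 1 * ‖z‖ ^ 3 := by ring
        _ ≤ 4 * Real.pi * ‖z‖ ^ 3 := by gcongr
        _ = _ := by ring
  have hK : ∀ z : R3, ‖bsKernel l z‖ ≤ (‖z‖ ^ 2)⁻¹ := fun z => by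
    refine le_of_eq_of_le ?_ (hb z)
    rw [Real.norm_eq_abs, bsKernel, abs_div, abs_of_nonneg (a := 4 * Real.pi * _) (by positivity)]
    ring_nf
  refine ⟨?_, ?_⟩
  · refine hx.mono ?_ (Eventually.of_forall fun y => ?_)
    · refine AEStronglyMeasurable.mul (Measurable.aestronglyMeasurable ?_)
        hcF.aestronglyMeasurable
      unfold bsKernel
      fun_prop
    · rw [norm_mul, mul_comm, norm_mul, norm_norm, norm_inv, norm_pow, norm_norm,
        Complex.norm_real]
      gcongr
      exact hK _
  have hae : ∀ᵐ y : R3, x - y ≠ 0 := by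
    filter_upwards [Measure.ae_ne volume x] with y hy
    exact sub_ne_zero.2 hy.symm
  -- The kernel is split as (z_l/2) · 1/(2π|z|³), the second factor being the Gaussian
  -- superposition.
  have h1 := integral_mul_integral_swap (c := fun y => 𝓕⁻ F y * (((x - y) l / 2 : ℝ) : ℂ))
    (k := fun y t => t ^ (1 / 2 : ℝ) * Real.exp (-(Real.pi * ‖x - y‖ ^ 2 * t)))
    (m := fun y => 1 / (2 * Real.pi * ‖x - y‖ ^ 3))
    (hcF.aestronglyMeasurable.mul (by fun_prop))
    (by unfold Function.uncurry; fun_prop) (fun y t ht => by positivity)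
    (by filter_upwards [hae] with y hy using integral_gaussian_kernel hy)
    (by
      refine hx.mono (AEStronglyMeasurable.mul (AEStronglyMeasurable.norm
        (hcF.aestronglyMeasurable.mul (by fun_prop)))
        (Measurable.aestronglyMeasurable (by fun_prop))) (Eventually.of_forall fun y => ?_)
      rw [Real.norm_of_nonneg (by positivity), Real.norm_of_nonneg (by positivity), norm_mul,
        mul_assoc]
      gcongr
      refine le_of_eq_of_le ?_ (hb (x - y))
      rw [Complex.norm_real, Real.norm_eq_abs, abs_div, abs_two]
      ring)
  -- The multiplier is split likewise as (-iξ_l/2) · 1/(π|ξ|²).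
  have h2 := integral_mul_integral_swap
    (c := fun ξ => F ξ * ((Real.fourierChar (inner ℝ ξ x) : ℂ) * (-Complex.I * (ξ l : ℂ) / 2)))
    (k := fun ξ t => t ^ (-2 : ℝ) * Real.exp (-(Real.pi * ‖ξ‖ ^ 2 * t ^ (-1 : ℝ))))
    (m := fun ξ => 1 / (Real.pi * ‖ξ‖ ^ 2))
    (hF.1.mul (Continuous.aestronglyMeasurable (by fun_prop)))
    (by unfold Function.uncurry; fun_prop) (fun y t ht => by positivity)
    (by
      filter_upwards [Measure.ae_ne volume (0 : R3)] with ξ hξ using integral_gaussian_multiplier hξ)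
    (by
      refine hF'.mono (AEStronglyMeasurable.mul (AEStronglyMeasurable.norm
        (hF.1.mul (Continuous.aestronglyMeasurable (by fun_prop))))
        (Measurable.aestronglyMeasurable (by fun_prop))) (Eventually.of_forall fun ξ => ?_)
      rw [Real.norm_of_nonneg (by positivity), Real.norm_of_nonneg (by positivity), norm_mul,
        mul_assoc]
      gcongr
      simp only [norm_mul, norm_div, Circle.norm_coe, one_mul, norm_neg, Complex.norm_I,
        Complex.norm_real, Complex.norm_ofNat]
      rcases eq_or_ne ξ 0 with h0 | h0
      · simp [h0]
      · have := norm_pos_iff.2 h0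
        rw [div_mul_div_comm, mul_one, inv_eq_one_div,
          div_le_div_iff₀ (by positivity) (by positivity)]
        have : 1 ≤ 2 * Real.pi := by nlinarith [Real.pi_gt_three]
        calc ‖ξ l‖ * ‖ξ‖ ≤ ‖ξ‖ * ‖ξ‖ := by gcongr; exact hcoord ξ
          _ = 1 * ‖ξ‖ ^ 2 := by ring
          _ ≤ 2 * Real.pi * ‖ξ‖ ^ 2 := by gcongr
          _ = _ := by ring)
  calc ∫ y : R3, (bsKernel l (x - y) : ℂ) * 𝓕⁻ F y
      = ∫ y : R3, 𝓕⁻ F y * (((x - y) l / 2 : ℝ) : ℂ) *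
          ((1 / (2 * Real.pi * ‖x - y‖ ^ 3) : ℝ) : ℂ) := by
        congr 1
        ext y
        rw [mul_assoc, ← Complex.ofReal_mul, mul_comm, bsKernel]
        congr 2
        ring
    _ = _ := h1
    _ = ∫ t in Ioi (0 : ℝ), ∫ ξ : R3, F ξ * ((Real.fourierChar (inner ℝ ξ x) : ℂ) *
          (-Complex.I * (ξ l : ℂ) / 2)) *
          ((t ^ (-2 : ℝ) * Real.exp (-(Real.pi * ‖ξ‖ ^ 2 * t ^ (-1 : ℝ))) : ℝ) : ℂ) := by
        refine setIntegral_congr_fun measurableSet_Ioi fun t (ht : 0 < t) => ?_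
        have h3 := congrArg (fun c => ((t ^ (1 / 2 : ℝ) / 2 : ℝ) : ℂ) * c)
          (integral_fourierInv_mul_gaussian hF ht l x)
        simp only [← integral_const_mul] at h3
        refine Eq.trans ?_ (h3.trans ?_)
        · congr 1
          ext y
          have : Complex.exp (-(Real.pi * t : ℝ) * (‖x - y‖ : ℂ) ^ 2) =
              ((Real.exp (-(Real.pi * ‖x - y‖ ^ 2 * t)) : ℝ) : ℂ) := by
            push_cast
            congr 1
            ring
          rw [this]
          push_cast
          ring
        · congr 1
          ext ξ
          -- The density t^{1/2} of the superposition times t^{-5/2} from the transformed Gaussian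
          -- gives the density t⁻² needed for the multiplier.
          have : t ^ (-2 : ℝ) = t ^ (1 / 2 : ℝ) * t ^ (-(5 / 2) : ℝ) := by
            rw [← Real.rpow_add ht]; norm_num
          rw [this, Real.rpow_neg_one]
          push_cast
          ring
    _ = _ := h2.symm
    _ = _ := by
        rw [Real.fourierInv_eq]
        congr 1
        ext ξ
        simp only [Circle.smul_def, smul_eq_mul, bsMul]
        push_cast
        ring

/-! ### The velocity as an inverse Fourier integral -/

/-- Near 0 the product is at most |F|² + |ξ|⁻², with |ξ|⁻² locally integrable; for |ξ| ≥ 1 it is at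
most |F|. -/
theorem integrable_norm_mul_inv_norm {F : R3 → ℂ} (hF : Integrable F) (hF2 : MemLp F 2 volume) :
    Integrable fun ξ => ‖F ξ‖ * ‖ξ‖⁻¹ := by
  have h2 : Integrable fun ξ => ‖F ξ‖ ^ 2 := hF2.integrable_norm_pow two_ne_zero
  have h3 := (integrable_indicator_iff Metric.isOpen_ball.measurableSet).2
    integrableOn_norm_rpow_neg_two
  refine ((hF.norm.add h2).add h3).mono' (hF.1.norm.mul (Measurable.aestronglyMeasurable
    (by fun_prop))) (Eventually.of_forall fun ξ => ?_)
  rw [Real.norm_of_nonneg (by positivity)]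
  simp only [Pi.add_apply]
  by_cases hξ : ξ ∈ Metric.ball (0 : R3) 1
  · rw [indicator_of_mem hξ, Real.rpow_neg (norm_nonneg _), Real.rpow_two, ← inv_pow]
    nlinarith [sq_nonneg (‖F ξ‖ - ‖ξ‖⁻¹), norm_nonneg (F ξ), sq_nonneg ‖F ξ‖, sq_nonneg ‖ξ‖⁻¹]
  · rw [indicator_of_notMem hξ]
    have h1 : 1 ≤ ‖ξ‖ := by simpa using hξ
    have : ‖F ξ‖ * ‖ξ‖⁻¹ ≤ ‖F ξ‖ * 1 := by
      gcongr
      exact inv_le_one_of_one_le₀ h1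
    nlinarith [sq_nonneg ‖F ξ‖]

/-- Near x the bound M meets the locally integrable |x - y|⁻²; away from x the product is at most
|g|² + |x - y|⁻⁴. -/
theorem integrable_norm_mul_inv_sq {g : R3 → ℂ} {M : ℝ} (hM : ∀ y, ‖g y‖ ≤ M)
    (hg : MemLp g 2 volume) (x : R3) : Integrable fun y => ‖g y‖ * (‖x - y‖ ^ 2)⁻¹ := by
  have h2 : Integrable fun y => ‖g y‖ ^ 2 := hg.integrable_norm_pow two_ne_zero
  have h3 := (((integrable_indicator_iff Metric.isOpen_ball.measurableSet).2
    integrableOn_norm_rpow_neg_two).comp_sub_left x).const_mul M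
  have h4 := (((integrable_indicator_iff Metric.isOpen_ball.measurableSet.compl).2
    (integrableOn_norm_rpow_compl_ball (r := 4) (by norm_num))).comp_sub_left x)
  refine ((h2.add h3).add h4).mono' (hg.1.norm.mul (Measurable.aestronglyMeasurable
    (by fun_prop))) (Eventually.of_forall fun y => ?_)
  rw [Real.norm_of_nonneg (by positivity)]
  simp only [Pi.add_apply]
  by_cases hy : x - y ∈ Metric.ball (0 : R3) 1
  · have hy' : x - y ∉ (Metric.ball (0 : R3) 1)ᶜ := fun h => h hy
    rw [indicator_of_mem hy, indicator_of_notMem hy', Real.rpow_neg (norm_nonneg _),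
      Real.rpow_two, add_zero]
    have : ‖g y‖ * (‖x - y‖ ^ 2)⁻¹ ≤ M * (‖x - y‖ ^ 2)⁻¹ := by
      gcongr
      exact hM y
    nlinarith [sq_nonneg ‖g y‖]
  · have hy' : x - y ∈ (Metric.ball (0 : R3) 1)ᶜ := hy
    rw [indicator_of_notMem hy, indicator_of_mem hy', Real.rpow_neg (norm_nonneg _), mul_zero,
      add_zero]
    have : (‖x - y‖ ^ (4 : ℝ))⁻¹ = ((‖x - y‖ ^ 2)⁻¹) ^ 2 := by
      rw [inv_pow, ← pow_mul]
      congr 1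
      exact_mod_cast Real.rpow_natCast ‖x - y‖ 4
    rw [this]
    nlinarith [sq_nonneg (‖g y‖ - (‖x - y‖ ^ 2)⁻¹), sq_nonneg ‖g y‖, sq_nonneg (‖x - y‖ ^ 2)⁻¹]

@[fun_prop]
theorem measurable_bsMul (l : Fin 3) : Measurable (bsMul l) := by
  unfold bsMul
  fun_prop

theorem two_pi_norm_mul_bsMul_le (l : Fin 3) (ξ : R3) :
    2 * Real.pi * ‖ξ‖ * ‖bsMul l ξ‖ ≤ 1 := by
  rcases eq_or_ne ξ 0 with h0 | h0
  · simp [h0]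
  · have := norm_pos_iff.2 h0
    have h1 : ‖bsMul l ξ‖ = ‖ξ l‖ / (2 * Real.pi * ‖ξ‖ ^ 2) := by
      rw [bsMul, norm_div, norm_mul, norm_neg, Complex.norm_I, one_mul, Complex.norm_real,
        Complex.norm_real, Real.norm_of_nonneg (r := 2 * Real.pi * _) (by positivity)]
    rw [h1, mul_div_assoc', div_le_one (by positivity)]
    calc 2 * Real.pi * ‖ξ‖ * ‖ξ l‖ ≤ 2 * Real.pi * ‖ξ‖ * ‖ξ‖ := by
          gcongr
          exact PiLp.norm_apply_le ξ l
      _ = _ := by ring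

theorem norm_bsMul_le (l : Fin 3) (ξ : R3) : ‖bsMul l ξ‖ ≤ ‖ξ‖⁻¹ := by
  rcases eq_or_ne ξ 0 with h0 | h0
  · simp [h0, bsMul]
  · have := norm_pos_iff.2 h0
    have h1 := two_pi_norm_mul_bsMul_le l ξ
    rw [inv_eq_one_div, le_div_iff₀ this]
    have h2 : 0 ≤ ‖bsMul l ξ‖ * ‖ξ‖ := by positivity
    nlinarith [Real.pi_gt_three]

/-- The involution P preserves measure, so y ↦ P y moves it from the kernel to f, and f ∘ P has
transform f̂ ∘ P. The identity serves as P for the unpermuted part of G. -/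
theorem bsKernel_convolution {f : L2} (hf : Integrable (hat f)) (l : Fin 3) {P : R3 ≃ₗᵢ[ℝ] R3}
    (hP : ∀ x, P (P x) = x) (x : R3) :
    Integrable (fun y => f y * bsKernel l (x - P y)) ∧
    Integrable (fun ξ => bsMul l ξ * hat f (P ξ)) ∧
    ((∫ y, f y * bsKernel l (x - P y) : ℝ) : ℂ) = 𝓕⁻ (fun ξ => bsMul l ξ * hat f (P ξ)) x := by
  have hPm := P.measurePreserving
  have hPe := P.toHomeomorph.measurableEmbedding
  have hF : Integrable fun ξ => hat f (P ξ) := (hPm.integrable_comp_emb hPe).2 hf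
  have hF2 : MemLp (fun ξ => hat f (P ξ)) 2 volume := (Lp.memLp (hat f)).comp_measurePreserving hPm
  have hinv : ∀ y, 𝓕⁻ (fun ξ => hat f (P ξ)) y = 𝓕⁻ (hat f : R3 → ℂ) (P y) :=
    fun y => Real.fourierInv_comp_linearIsometry P (hat f : R3 → ℂ) y
  have hfe := ae_eq_fourierInv_hat hf
  have hg : MemLp (𝓕⁻ (fun ξ => hat f (P ξ))) 2 volume := by
    have h1 : MemLp (𝓕⁻ (hat f : R3 → ℂ)) 2 volume := by
      refine (memLp_congr_ae ?_).1 (Lp.memLp (toC f))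
      filter_upwards [hfe, toC_ae f] with y h1 h2
      rw [h2, h1]
    have h2 := h1.comp_measurePreserving hPm
    exact (memLp_congr_ae (Eventually.of_forall fun y => (hinv y).symm)).1 h2
  have hF' := integrable_norm_mul_inv_norm hF hF2
  obtain ⟨h1, h2⟩ := integral_bsKernel_mul_fourierInv hF hF' l x
    (integrable_norm_mul_inv_sq (norm_fourierInv_le _) hg x)
  have hc : (fun y => (bsKernel l (x - P y) : ℂ) * 𝓕⁻ (fun ξ => hat f (P ξ)) (P y)) =ᵐ[volume]
      fun y => ((f y * bsKernel l (x - P y) : ℝ) : ℂ) := by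
    filter_upwards [hfe] with y hy
    rw [hinv, hP, ← hy]
    push_cast
    ring
  have h1' := (hPm.integrable_comp_emb hPe).2 h1
  refine ⟨?_, ?_, ?_⟩
  · have := (h1'.congr hc).re
    simpa using this
  · refine hF'.mono (AEStronglyMeasurable.mul (Measurable.aestronglyMeasurable ?_) hF.1)
      (Eventually.of_forall fun ξ => ?_)
    · exact measurable_bsMul l
    · rw [norm_mul, mul_comm, norm_mul, norm_norm, norm_inv, norm_norm]
      gcongr
      exact norm_bsMul_le l ξ
  · have h3 := (hPm.integral_comp hPe fun y =>
      (bsKernel l (x - y) : ℂ) * 𝓕⁻ (fun ξ => hat f (P ξ)) y).symm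
    rw [← h2, h3, integral_congr_ae hc, integral_complex_ofReal]

/-- The Fourier transform of the velocity. -/
def velHat (f : L2) (j : Fin 3) (ξ : R3) : ℂ :=
  ![-(bsMul 2 ξ * hat f (P12 ξ)) + bsMul 1 ξ * hat f (P13 ξ),
    -(bsMul 2 ξ * hat f ξ) - bsMul 0 ξ * hat f (P13 ξ),
    bsMul 1 ξ * hat f ξ + bsMul 0 ξ * hat f (P12 ξ)] j

theorem P12_P12 (x : R3) : P12 (P12 x) = x := by
  ext k; fin_cases k <;> rfl

theorem P13_P13 (x : R3) : P13 (P13 x) = x := by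
  ext k; fin_cases k <;> rfl

theorem kernelG_apply (x y : R3) : kernelG x y =
    !₂[-bsKernel 2 (x - P12 y) + bsKernel 1 (x - P13 y),
      -bsKernel 2 (x - y) - bsKernel 0 (x - P13 y),
      bsKernel 1 (x - y) + bsKernel 0 (x - P12 y)] := by
  have h12 : ∀ k, (x - P12 y) k = x k - (!₂[y 1, y 0, y 2] : R3) k := fun k => by
    rw [← P12_apply]; rfl
  have h13 : ∀ k, (x - P13 y) k = x k - (!₂[y 2, y 1, y 0] : R3) k := fun k => by
    rw [← P13_apply]; rfl
  ext k
  fin_cases k <;> simp [kernelG, bsKernel, h12, h13] <;> ring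

theorem fourierInv_add {F G : R3 → ℂ} (hF : Integrable F) (hG : Integrable G) (x : R3) :
    𝓕⁻ (fun ξ => F ξ + G ξ) x = 𝓕⁻ F x + 𝓕⁻ G x :=
  congrFun (VectorFourier.fourierIntegral_add (L := -innerₗ R3) Real.continuous_fourierChar
    (by simp only [LinearMap.neg_apply, innerₗ_apply_apply]; fun_prop) hF hG) x

theorem fourierInv_neg (F : R3 → ℂ) (x : R3) : 𝓕⁻ (fun ξ => -F ξ) x = -𝓕⁻ F x := by
  simp only [Real.fourierInv_eq, smul_neg, integral_neg]

theorem smul_kernelG_apply (f : L2) (x y : R3) (k : Fin 3) : (f y • kernelG x y) k =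
    ![-(f y * bsKernel 2 (x - P12 y)) + f y * bsKernel 1 (x - P13 y),
      -(f y * bsKernel 2 (x - y)) + -(f y * bsKernel 0 (x - P13 y)),
      f y * bsKernel 1 (x - y) + f y * bsKernel 0 (x - P12 y)] k := by
  rw [kernelG_apply]
  fin_cases k <;> simp <;> ring

theorem integrable_smul_kernelG {f : L2} (hf : Integrable (hat f)) (x : R3) :
    Integrable fun y => f y • kernelG x y := by
  have h0 := fun l => (bsKernel_convolution hf l (P := LinearIsometryEquiv.refl ℝ R3)
    (fun _ => rfl) x).1
  have h1 := fun l => (bsKernel_convolution hf l P12_P12 x).1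
  have h2 := fun l => (bsKernel_convolution hf l P13_P13 x).1
  refine Integrable.of_eval_piLp fun k => ?_
  simp only [smul_kernelG_apply]
  fin_cases k
  · exact (h1 2).neg.add (h2 1)
  · exact (h0 2).neg.add (h2 0).neg
  · exact (h0 1).add (h1 0)

theorem velocity_add {f g : L2} (hf : Integrable (hat f)) (hg : Integrable (hat g)) (x : R3) :
    velocity (f + g) x = velocity f x + velocity g x := by
  rw [velocity, velocity, velocity,
    ← integral_add (integrable_smul_kernelG hf x) (integrable_smul_kernelG hg x)]
  refine integral_congr_ae ?_
  filter_upwards [Lp.coeFn_add f g] with y hy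
  rw [hy, Pi.add_apply, add_smul]

theorem velocity_sub {f g : L2} (hf : Integrable (hat f)) (hg : Integrable (hat g)) (x : R3) :
    velocity (f - g) x = velocity f x - velocity g x := by
  rw [velocity, velocity, velocity,
    ← integral_sub (integrable_smul_kernelG hf x) (integrable_smul_kernelG hg x)]
  refine integral_congr_ae ?_
  filter_upwards [Lp.coeFn_sub f g] with y hy
  rw [hy, Pi.sub_apply, sub_smul]

theorem velocity_eq {f : L2} (hf : Integrable (hat f)) (x : R3) (j : Fin 3) :
    (velocity f x j : ℂ) = 𝓕⁻ (velHat f j) x := by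
  have h0 := fun l => bsKernel_convolution hf l (P := LinearIsometryEquiv.refl ℝ R3)
    (fun _ => rfl) x
  have h1 := fun l => bsKernel_convolution hf l P12_P12 x
  have h2 := fun l => bsKernel_convolution hf l P13_P13 x
  simp only [LinearIsometryEquiv.coe_refl, id_eq] at h0
  rw [velocity, eval_integral_piLp (integrable_smul_kernelG hf x).eval_piLp]
  simp only [smul_kernelG_apply]
  fin_cases j
  · change ((∫ y, -(f y * bsKernel 2 (x - P12 y)) + f y * bsKernel 1 (x - P13 y) : ℝ) : ℂ) =
      𝓕⁻ (fun ξ => -(bsMul 2 ξ * hat f (P12 ξ)) + bsMul 1 ξ * hat f (P13 ξ)) x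
    rw [integral_add (h1 2).1.fun_neg (h2 1).1, fourierInv_add (h1 2).2.1.fun_neg (h2 1).2.1,
      fourierInv_neg, integral_neg, ← (h1 2).2.2, ← (h2 1).2.2]
    push_cast
    rfl
  · change ((∫ y, -(f y * bsKernel 2 (x - y)) + -(f y * bsKernel 0 (x - P13 y)) : ℝ) : ℂ) =
      𝓕⁻ (fun ξ => -(bsMul 2 ξ * hat f ξ) - bsMul 0 ξ * hat f (P13 ξ)) x
    simp only [sub_eq_add_neg (-(bsMul 2 _ * _))]
    rw [integral_add (h0 2).1.fun_neg (h2 0).1.fun_neg,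
      fourierInv_add (h0 2).2.1.fun_neg (h2 0).2.1.fun_neg,
      fourierInv_neg, fourierInv_neg, integral_neg, integral_neg, ← (h0 2).2.2, ← (h2 0).2.2]
    push_cast
    rfl
  · change ((∫ y, f y * bsKernel 1 (x - y) + f y * bsKernel 0 (x - P12 y) : ℝ) : ℂ) =
      𝓕⁻ (fun ξ => bsMul 1 ξ * hat f ξ + bsMul 0 ξ * hat f (P12 ξ)) x
    rw [integral_add (h0 1).1 (h1 0).1, fourierInv_add (h0 1).2.1 (h1 0).2.1,
      ← (h0 1).2.2, ← (h1 0).2.2]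
    push_cast
    rfl

theorem integrable_velHat {f : L2} (hf : Integrable (hat f)) (j : Fin 3) :
    Integrable (velHat f j) := by
  have h0 := fun l => (bsKernel_convolution hf l (P := LinearIsometryEquiv.refl ℝ R3)
    (fun _ => rfl) 0).2.1
  have h1 := fun l => (bsKernel_convolution hf l P12_P12 0).2.1
  have h2 := fun l => (bsKernel_convolution hf l P13_P13 0).2.1
  fin_cases j
  · exact (h1 2).neg.add (h2 1)
  · exact (h0 2).neg.sub (h2 0)
  · exact (h0 1).add (h1 0)

theorem measurable_velHat (f : L2) (j : Fin 3) : Measurable (velHat f j) := by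
  have h0 : Measurable (hat f : R3 → ℂ) := (Lp.stronglyMeasurable _).measurable
  have h1 : Measurable fun ξ => hat f (P12 ξ) := h0.comp P12.continuous.measurable
  have h2 : Measurable fun ξ => hat f (P13 ξ) := h0.comp P13.continuous.measurable
  fin_cases j
  · exact ((measurable_bsMul 2).mul h1).neg.add ((measurable_bsMul 1).mul h2)
  · exact ((measurable_bsMul 2).mul h0).neg.sub ((measurable_bsMul 0).mul h2)
  · exact ((measurable_bsMul 1).mul h0).add ((measurable_bsMul 0).mul h1)

/-- Incompressibility: `bsMul l` is proportional to ξ_l, so for each of the three rearrangements of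
f̂ the two contributions cancel. -/
theorem sum_coord_velHat (f : L2) (ξ : R3) : ∑ j, (ξ j : ℂ) * velHat f j ξ = 0 := by
  simp only [Fin.sum_univ_three, velHat, bsMul, Matrix.cons_val_zero, Matrix.cons_val_one,
    Matrix.cons_val]
  ring

/-- The sum of the sizes of the three rearranged transforms. -/
def permSum (f : L2) (ξ : R3) : ℝ := ‖hat f ξ‖ + ‖hat f (P12 ξ)‖ + ‖hat f (P13 ξ)‖

/-- The gain of one derivative: |ξ| cancels the singularity of `bsMul`, and each component uses two
of the three rearrangements. -/
theorem norm_velHat_le (f : L2) (j : Fin 3) (ξ : R3) :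
    2 * Real.pi * ‖ξ‖ * ‖velHat f j ξ‖ ≤ permSum f ξ := by
  have key : ∀ (l m : Fin 3) (a b : ℂ), 2 * Real.pi * ‖ξ‖ * (‖bsMul l ξ * a‖ + ‖bsMul m ξ * b‖) ≤
      ‖a‖ + ‖b‖ := fun l m a b => by
    have h1 := mul_le_mul_of_nonneg_right (two_pi_norm_mul_bsMul_le l ξ) (norm_nonneg a)
    have h2 := mul_le_mul_of_nonneg_right (two_pi_norm_mul_bsMul_le m ξ) (norm_nonneg b)
    rw [norm_mul, norm_mul]
    linarith
  have h0 := norm_nonneg (hat f ξ)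
  have h1 := norm_nonneg (hat f (P12 ξ))
  have h2 := norm_nonneg (hat f (P13 ξ))
  have hp : 0 ≤ 2 * Real.pi * ‖ξ‖ := by positivity
  unfold permSum
  fin_cases j
  · refine (mul_le_mul_of_nonneg_left (norm_add_le _ _) hp).trans ?_
    rw [norm_neg]
    linarith [key 2 1 (hat f (P12 ξ)) (hat f (P13 ξ))]
  · refine (mul_le_mul_of_nonneg_left (norm_sub_le _ _) hp).trans ?_
    rw [norm_neg]
    linarith [key 2 0 (hat f ξ) (hat f (P13 ξ))]
  · refine (mul_le_mul_of_nonneg_left (norm_add_le _ _) hp).trans ?_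
    linarith [key 1 0 (hat f ξ) (hat f (P12 ξ))]

theorem integrable_comp_swap {F : R3 → ℂ} (hF : Integrable F) (P : R3 ≃ₗᵢ[ℝ] R3) :
    Integrable fun ξ => F (P ξ) :=
  (P.measurePreserving.integrable_comp_emb P.toHomeomorph.measurableEmbedding).2 hF

theorem integrable_permSum {f : L2} (hf : Integrable (hat f)) : Integrable (permSum f) :=
  (hf.norm.add (integrable_comp_swap hf P12).norm).add (integrable_comp_swap hf P13).norm

theorem integral_permSum {f : L2} (hf : Integrable (hat f)) :
    ∫ ξ, permSum f ξ = 3 * ∫ ξ, ‖hat f ξ‖ := by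
  have h : ∀ P : R3 ≃ₗᵢ[ℝ] R3, ∫ ξ, ‖hat f (P ξ)‖ = ∫ ξ, ‖hat f ξ‖ := fun P =>
    P.measurePreserving.integral_comp P.toHomeomorph.measurableEmbedding fun ξ => ‖hat f ξ‖
  unfold permSum
  rw [integral_add (hf.norm.fun_add (integrable_comp_swap hf P12).norm)
    (integrable_comp_swap hf P13).norm, integral_add hf.norm (integrable_comp_swap hf P12).norm,
    h, h]
  ring

theorem memLp_permSum (f : L2) : MemLp (permSum f) 2 volume :=
  ((Lp.memLp (hat f)).norm.add ((Lp.memLp (hat f)).comp_measurePreserving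
    P12.measurePreserving).norm).add ((Lp.memLp (hat f)).comp_measurePreserving
    P13.measurePreserving).norm

theorem enorm_hat (f : L2) : ‖hat f‖ₑ = ‖f‖ₑ := by
  rw [← enorm_norm, norm_hat, enorm_norm]

theorem eLpNorm_permSum_le (f : L2) : eLpNorm (permSum f) 2 volume ≤ 3 * ‖f‖ₑ := by
  have h : ∀ P : R3 ≃ₗᵢ[ℝ] R3, eLpNorm (fun ξ => ‖hat f (P ξ)‖) 2 volume = ‖f‖ₑ := fun P => by
    rw [eLpNorm_norm, ← enorm_hat f, Lp.enorm_def]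
    exact eLpNorm_comp_measurePreserving (Lp.aestronglyMeasurable _) P.measurePreserving
  have h0 := h (LinearIsometryEquiv.refl ℝ R3)
  have hm : ∀ P : R3 ≃ₗᵢ[ℝ] R3, AEStronglyMeasurable (fun ξ => ‖hat f (P ξ)‖) volume := fun P =>
    ((Lp.memLp (hat f)).comp_measurePreserving P.measurePreserving).norm.1
  have hm0 := hm (LinearIsometryEquiv.refl ℝ R3)
  simp only [LinearIsometryEquiv.coe_refl, id_eq] at h0 hm0
  refine (eLpNorm_add_le (hm0.add (hm P12)) (hm P13) (by norm_num)).trans ?_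
  refine (add_le_add_left (eLpNorm_add_le hm0 (hm P12) (by norm_num)) _).trans ?_
  rw [h0, h, h]
  exact le_of_eq (by ring)

theorem integrable_norm_mul_velHat {f : L2} (hf : Integrable (hat f)) (j : Fin 3) :
    Integrable fun ξ => (‖ξ‖ : ℂ) * velHat f j ξ := by
  refine (integrable_permSum hf).mono' (AEStronglyMeasurable.mul (by fun_prop)
    (measurable_velHat f j).aestronglyMeasurable) (Eventually.of_forall fun ξ => ?_)
  have h1 := norm_velHat_le f j ξ
  rw [norm_mul, Complex.norm_real, norm_norm]
  have h2 : 0 ≤ ‖ξ‖ * ‖velHat f j ξ‖ := by positivity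
  nlinarith [Real.pi_gt_three]

theorem lintegral_norm_sq_mul_velHat_le (f : L2) (j : Fin 3) :
    ∫⁻ ξ, ENNReal.ofReal (‖ξ‖ ^ 2) * ‖velHat f j ξ‖ₑ ^ 2 ≤ 9 * ‖f‖ₑ ^ 2 := by
  have h1 : ∫⁻ ξ, ‖permSum f ξ‖ₑ ^ 2 ≤ 9 * ‖f‖ₑ ^ 2 := by
    have h2 := pow_le_pow_left' (eLpNorm_permSum_le f) 2
    rw [eLpNorm_eq_lintegral_rpow_enorm_toReal (by norm_num) (by norm_num),
      ← ENNReal.rpow_natCast, ← ENNReal.rpow_mul, mul_pow] at h2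
    norm_num at h2
    exact h2
  refine le_trans (lintegral_mono fun ξ => ?_) h1
  rw [ENNReal.ofReal_pow (norm_nonneg _), ofReal_norm, ← mul_pow, ← enorm_norm ξ,
    ← enorm_norm (velHat f j ξ), ← enorm_mul]
  refine pow_le_pow_left' (enorm_le_iff_norm_le.2 ?_) 2
  have h1 := norm_velHat_le f j ξ
  have h2 : 0 ≤ ‖ξ‖ * ‖velHat f j ξ‖ := by positivity
  rw [Real.norm_of_nonneg h2]
  refine le_trans ?_ (le_abs_self _)
  nlinarith [Real.pi_gt_three]

/-! ### The gradient of the velocity -/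

/-- The transform of the partial derivatives of the first velocity component. -/
def gradHat (f : L2) (k : Fin 3) (ξ : R3) : ℂ :=
  2 * Real.pi * Complex.I * (ξ k : ℂ) * velHat f 0 ξ

theorem norm_gradHat_le (f : L2) (k : Fin 3) (ξ : R3) : ‖gradHat f k ξ‖ ≤ permSum f ξ := by
  refine le_trans ?_ (norm_velHat_le f 0 ξ)
  simp only [gradHat, norm_mul, Complex.norm_real, Complex.norm_I, mul_one, Complex.norm_ofNat,
    Real.norm_of_nonneg Real.pi_pos.le]
  gcongr
  exact PiLp.norm_apply_le ξ k

/-- Weak derivatives are unique, so any representative agrees with the classical derivative of the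
inverse Fourier integral. -/
theorem gradVelocity_ae {f : L2} (hf : Integrable (hat f)) {k : Fin 3} {d : R3 → ℝ}
    (hd : IsWeakPartial k (fun x => velocity f x 0) d) :
    ∀ᵐ x, d x = (𝓕⁻ (gradHat f k) x).re :=
  isWeakPartial_ae_eq hd (isWeakPartial_of_fourierInv (integrable_velHat hf 0)
    (integrable_norm_mul_velHat hf 0) (fun x => velocity_eq hf x 0) k)

theorem integrable_gradHat {f : L2} (hf : Integrable (hat f)) (k : Fin 3) :
    Integrable (gradHat f k) :=
  integrable_coord_mul (measurable_velHat f 0).aestronglyMeasurable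
    (integrable_norm_mul_velHat hf 0) k

theorem abs_gradVelocity_le {f : L2} (hf : Integrable (hat f)) {k : Fin 3} {d : R3 → ℝ}
    (hd : IsWeakPartial k (fun x => velocity f x 0) d) :
    ∀ᵐ x, |d x| ≤ 3 * ∫ ξ, ‖hat f ξ‖ := by
  filter_upwards [gradVelocity_ae hf hd] with x hx
  rw [hx, ← integral_permSum hf]
  refine (Complex.abs_re_le_norm _).trans ((norm_fourierInv_le _ _).trans ?_)
  exact integral_mono (integrable_gradHat hf k).norm (integrable_permSum hf)
    fun ξ => norm_gradHat_le f k ξ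

theorem eLpNorm_gradVelocity_le {f : L2} (hf : Integrable (hat f)) {k : Fin 3} {d : R3 → ℝ}
    (hd : IsWeakPartial k (fun x => velocity f x 0) d) :
    AEStronglyMeasurable d ∧ eLpNorm d 2 volume ≤ 3 * ‖f‖ₑ := by
  have hi := integrable_gradHat hf k
  have hG : MemLp (gradHat f k) 2 volume := (memLp_permSum f).mono' hi.1
    (Eventually.of_forall fun ξ => norm_gradHat_le f k ξ)
  have h1 := fourierInv_ae_eq (f := hG.toLp) (hi.congr hG.coeFn_toLp.symm)
  have h2 : ∀ᵐ x, d x = ((𝓕⁻ hG.toLp : Lp ℂ 2 (volume : Measure R3)) x).re := by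
    filter_upwards [gradVelocity_ae hf hd, h1] with x hx h1
    rw [hx, h1, Real.fourierInv_congr_ae hG.coeFn_toLp]
  refine ⟨hd.2.1.aestronglyMeasurable, ?_⟩
  calc eLpNorm d 2 volume ≤ eLpNorm (𝓕⁻ hG.toLp : Lp ℂ 2 (volume : Measure R3)) 2 volume := by
        refine eLpNorm_mono_ae ?_
        filter_upwards [h2] with x hx
        rw [hx]
        exact Complex.abs_re_le_norm _
    _ = ‖(𝓕⁻ hG.toLp : Lp ℂ 2 (volume : Measure R3))‖ₑ := (Lp.enorm_def _).symm
    _ = ‖hG.toLp‖ₑ := by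
        rw [← enorm_norm, ← Lp.norm_fourier_eq, FourierTransform.fourier_fourierInv_eq, enorm_norm]
    _ = eLpNorm (gradHat f k) 2 volume := by
        rw [Lp.enorm_def, eLpNorm_congr_ae hG.coeFn_toLp]
    _ ≤ eLpNorm (permSum f) 2 volume := eLpNorm_mono fun ξ =>
        (norm_gradHat_le f k ξ).trans (le_abs_self _)
    _ ≤ _ := eLpNorm_permSum_le f

/-! ### Trilinear forms on the Fourier side -/

theorem integrable_mul_L2 (a b : L2) : Integrable fun x => a x * b x :=
  (Lp.memLp a).integrable_mul (Lp.memLp b)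

theorem integrable_mul_L2_complex (a b : L2) : Integrable fun x => (a x : ℂ) * (b x : ℂ) := by
  simpa using (integrable_mul_L2 a b).ofReal (𝕜 := ℂ)

theorem integrable_conj_hat_mul_hat (a b : L2) (ξ : R3) :
    Integrable fun η => (starRingEnd ℂ) (hat a η) * hat b (η - ξ) :=
  (Lp.memLp (hat a)).star.integrable_mul
    ((Lp.memLp (hat b)).comp_measurePreserving (measurePreserving_sub_right volume ξ))

/-- The transform of a product of square integrable functions. -/
theorem fourierInv_mul_eq (a b : L2) (ξ : R3) :
    𝓕⁻ (fun x => (a x : ℂ) * (b x : ℂ)) ξ = ∫ η, (starRingEnd ℂ) (hat a η) * hat b (η - ξ) := by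
  -- Parseval for a and the modulated b: modulation by ξ shifts b̂ by ξ, and a is real, so the inner
  -- product is the integral sought.
  have hm : MemLp (fun x => (Real.fourierChar (inner ℝ ξ x) : ℂ) * toC b x) 2 volume := by
    refine (Lp.memLp (toC b)).mono (AEStronglyMeasurable.mul
      (Continuous.aestronglyMeasurable (by fun_prop)) (Lp.aestronglyMeasurable _))
      (Eventually.of_forall fun x => ?_)
    rw [norm_mul, Circle.norm_coe, one_mul]
  have h1 := fourier_modulation (f := toC b) (g := hm.toLp) ξ hm.coeFn_toLp
  have h2 := Lp.inner_fourier_eq (toC a) hm.toLp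
  rw [L2.inner_def, L2.inner_def] at h2
  rw [Real.fourierInv_eq]
  refine Eq.trans (Eq.trans (integral_congr_ae ?_) h2.symm) (integral_congr_ae ?_)
  · filter_upwards [hm.coeFn_toLp, toC_ae a, toC_ae b] with x h1 h2 h3
    rw [h1, h2, h3]
    simp only [Circle.smul_def, smul_eq_mul, RCLike.inner_apply, Complex.conj_ofReal,
      real_inner_comm x ξ]
    ring
  · filter_upwards [h1] with η h1
    rw [h1, RCLike.inner_apply, ← hat_eq, ← hat_eq, mul_comm]

theorem integral_mul_mul_eq {F : R3 → ℂ} (hF : Integrable F) {u : R3 → ℝ}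
    (hu : ∀ x, (u x : ℂ) = 𝓕⁻ F x) (a b : L2) :
    ((∫ x, u x * a x * b x : ℝ) : ℂ) =
      ∫ ξ, F ξ * ∫ η, (starRingEnd ℂ) (hat a η) * hat b (η - ξ) := by
  have h := integral_fourierInv_mul hF (integrable_mul_L2_complex a b)
  simp only [fourierInv_mul_eq] at h
  rw [← h, ← integral_complex_ofReal]
  congr 1
  ext x
  push_cast
  rw [hu, mul_assoc]

theorem enorm_integral_mul_mul_le {F : R3 → ℂ} (hF : Integrable F) {u : R3 → ℝ}
    (hu : ∀ x, (u x : ℂ) = 𝓕⁻ F x) (a b : L2) :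
    ‖∫ x, u x * a x * b x‖ₑ ≤ ∫⁻ ξ, ∫⁻ η, ‖F ξ‖ₑ * ‖hat a η‖ₑ * ‖hat b (η - ξ)‖ₑ := by
  have h1 : ‖∫ x, u x * a x * b x‖ₑ = ‖((∫ x, u x * a x * b x : ℝ) : ℂ)‖ₑ := by
    rw [← enorm_norm (((∫ x, u x * a x * b x : ℝ) : ℂ)), Complex.norm_real, enorm_norm]
  rw [h1, integral_mul_mul_eq hF hu a b]
  refine (enorm_integral_le_lintegral_enorm _).trans (lintegral_mono fun ξ => ?_)
  rw [enorm_mul]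
  simp only [mul_assoc]
  rw [lintegral_const_mul' _ _ enorm_ne_top]
  gcongr
  refine (enorm_integral_le_lintegral_enorm _).trans_eq ?_
  congr 1
  ext η
  rw [enorm_mul]
  congr 1
  exact RCLike.enorm_conj _

/-- The Fourier form of d g = ½ ∂_j(g²). The pairing is symmetric because d g = g d, and adding both
orders gives the factor conj(2πi η_j) + 2πi(η_j - ξ_j) = -2πi ξ_j. -/
theorem transport_pairing {g d : L2} {j : Fin 3}
    (hd : ∀ᵐ ξ, hat d ξ = 2 * Real.pi * Complex.I * (ξ j : ℂ) * hat g ξ) (ξ : R3) :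
    ∫ η, (starRingEnd ℂ) (hat d η) * hat g (η - ξ) =
      -(Real.pi * Complex.I * (ξ j : ℂ)) * ∫ η, (starRingEnd ℂ) (hat g η) * hat g (η - ξ) := by
  have hsymm : ∫ η, (starRingEnd ℂ) (hat d η) * hat g (η - ξ) =
      ∫ η, (starRingEnd ℂ) (hat g η) * hat d (η - ξ) := by
    rw [← fourierInv_mul_eq, ← fourierInv_mul_eq]
    exact Real.fourierInv_congr_ae (Eventually.of_forall fun x => mul_comm _ _) ξ
  have hd' : ∀ᵐ η, hat d (η - ξ) =
      2 * Real.pi * Complex.I * ((η - ξ) j : ℂ) * hat g (η - ξ) :=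
    (measurePreserving_sub_right volume ξ).quasiMeasurePreserving.ae hd
  have hsum : (∫ η, (starRingEnd ℂ) (hat d η) * hat g (η - ξ)) +
      ∫ η, (starRingEnd ℂ) (hat g η) * hat d (η - ξ) =
      -(2 * Real.pi * Complex.I * (ξ j : ℂ)) *
        ∫ η, (starRingEnd ℂ) (hat g η) * hat g (η - ξ) := by
    rw [← integral_add (integrable_conj_hat_mul_hat d g ξ) (integrable_conj_hat_mul_hat g d ξ),
      ← integral_const_mul]
    refine integral_congr_ae ?_
    filter_upwards [hd, hd'] with η h1 h2
    rw [h1, h2]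
    simp only [map_mul, Complex.conj_ofReal, Complex.conj_I, PiLp.sub_apply, Complex.ofReal_sub,
      map_ofNat]
    ring
  rw [← hsymm] at hsum
  linear_combination hsum / 2

/-- The transport term does not contribute to the energy balance. -/
theorem sum_integral_transport {h g : L2} (hh : Integrable (hat h)) {d : Fin 3 → L2}
    (hd : ∀ j, ∀ᵐ ξ, hat (d j) ξ = 2 * Real.pi * Complex.I * (ξ j : ℂ) * hat g ξ) :
    ∑ j, ∫ x, velocity h x j * d j x * g x = 0 := by
  have h1 : ((∑ j, ∫ x, velocity h x j * d j x * g x : ℝ) : ℂ) = 0 := by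
    push_cast
    -- The inner pairing is the transform of an L¹ product, hence bounded and continuous.
    have hi : ∀ j, Integrable fun ξ => velHat h j ξ *
        ∫ η, (starRingEnd ℂ) (hat (d j) η) * hat g (η - ξ) := fun j => by
      simp only [← fourierInv_mul_eq]
      refine (integrable_velHat hh j).mul_bdd (c := ∫ x, ‖(d j x : ℂ) * (g x : ℂ)‖)
        (continuous_fourierInv_of_integrable
          (integrable_mul_L2_complex (d j) g)).aestronglyMeasurable
        (Eventually.of_forall fun ξ => norm_fourierInv_le _ _)
    calc _ = ∑ j, ∫ ξ, velHat h j ξ * ∫ η, (starRingEnd ℂ) (hat (d j) η) * hat g (η - ξ) :=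
          Finset.sum_congr rfl fun j _ =>
            integral_mul_mul_eq (integrable_velHat hh j) (fun x => velocity_eq hh x j) (d j) g
      _ = ∫ ξ, ∑ j, velHat h j ξ * ∫ η, (starRingEnd ℂ) (hat (d j) η) * hat g (η - ξ) :=
          (integral_finsetSum _ fun j _ => hi j).symm
      _ = ∫ ξ : R3, (0 : ℂ) := by
          congr 1
          ext ξ
          simp only [transport_pairing (hd _)]
          have := sum_coord_velHat h ξ
          rw [Fin.sum_univ_three] at this ⊢
          linear_combination (-(Real.pi * Complex.I) *
            ∫ η, (starRingEnd ℂ) (hat g η) * hat g (η - ξ)) * this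
      _ = 0 := integral_zero _ _
  exact_mod_cast h1

/-- The bound for the term in which the difference velocity acts on the sum of the solutions. -/
theorem exists_velocity_term_bound {s : ℝ} (hs : 3 / 2 < s) :
    ∃ K : ℝ≥0∞, K < ⊤ ∧ ∀ (g h d : L2) (j : Fin 3), Integrable (hat g) →
      (∀ᵐ ξ, hat d ξ = 2 * Real.pi * Complex.I * (ξ j : ℂ) * hat h ξ) →
      ‖∫ x, velocity g x j * d x * g x‖ₑ ≤ K * hsNorm s h * ‖g‖ₑ ^ 2 := by
  obtain ⟨K, hK, hb⟩ := exists_trilinear_bound hs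
  -- The square root of 9K, where 9 comes from the Ḣ¹ bound of the velocity.
  refine ⟨3 * K ^ (1 / 2 : ℝ), ENNReal.mul_lt_top (by norm_num)
    (ENNReal.rpow_lt_top_of_nonneg (by norm_num) hK.ne), fun g h d j hg hd => ?_⟩
  refine (enorm_integral_mul_mul_le (integrable_velHat hg j)
    (fun x => velocity_eq hg x j) d g).trans ?_
  refine (ENNReal.pow_right_strictMono two_ne_zero).le_iff_le.1 ?_
  refine (hb (fun ξ => ‖velHat g j ξ‖ₑ) (fun η => ‖hat d η‖ₑ) (fun ζ => ‖hat g ζ‖ₑ)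
    (measurable_velHat g j).enorm (measurable_hat d) (measurable_hat g)).trans ?_
  have h1 : ∫⁻ η, ENNReal.ofReal (jb η ^ (s - 1)) * ‖hat d η‖ₑ ^ 2 ≤ hsNorm s h ^ 2 := by
    rw [hsNorm_sq]
    refine lintegral_mono_ae ?_
    filter_upwards [hd] with η hη
    have hj := jb_pos η
    have h2 : ‖hat d η‖ₑ ^ 2 ≤ ENNReal.ofReal (jb η) * ‖hat h η‖ₑ ^ 2 := by
      rw [hη, enorm_mul, mul_pow]
      gcongr
      rw [← ofReal_norm, ← ENNReal.ofReal_pow (norm_nonneg _)]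
      refine ENNReal.ofReal_le_ofReal ?_
      simp only [norm_mul, Complex.norm_real, Complex.norm_I, mul_one, Complex.norm_ofNat,
        Real.norm_of_nonneg Real.pi_pos.le]
      have h3 : ‖η j‖ ^ 2 ≤ ‖η‖ ^ 2 := by
        gcongr
        exact PiLp.norm_apply_le η j
      have h4 : 0 ≤ 4 * Real.pi ^ 2 := by positivity
      unfold jb
      nlinarith
    calc _ ≤ ENNReal.ofReal (jb η ^ (s - 1)) * (ENNReal.ofReal (jb η) * ‖hat h η‖ₑ ^ 2) := by
          gcongr
      _ = _ := by
          rw [← mul_assoc, ← ENNReal.ofReal_mul (by positivity), ← Real.rpow_add_one hj.ne',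
            sub_add_cancel]
  have h2 : ∫⁻ ζ, ‖hat g ζ‖ₑ ^ 2 = ‖g‖ₑ ^ 2 := by
    rw [← enorm_sq_L2, enorm_hat]
  rw [h2]
  calc _ ≤ K * (9 * ‖g‖ₑ ^ 2) * hsNorm s h ^ 2 * ‖g‖ₑ ^ 2 := by
        gcongr
        exact lintegral_norm_sq_mul_velHat_le g j
    _ = _ := by
        have e : (K ^ (1 / 2 : ℝ)) ^ 2 = K := by
          rw [← ENNReal.rpow_natCast, ← ENNReal.rpow_mul]; simp
        rw [mul_pow, mul_pow, mul_pow, e]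
        ring

theorem memLp_partial_hat {s : ℝ} (hs : 1 ≤ s) {f : L2} (hf : hsNorm s f < ⊤) (j : Fin 3) :
    MemLp (fun ξ => 2 * Real.pi * Complex.I * (ξ j : ℂ) * hat f ξ) 2 volume := by
  refine ⟨AEStronglyMeasurable.mul (by fun_prop) (Lp.aestronglyMeasurable _), ?_⟩
  have h1 : hsNorm 1 f ^ 2 < ⊤ := ENNReal.pow_lt_top ((hsNorm_mono hs f).trans_lt hf)
  rw [hsNorm_sq] at h1
  rw [eLpNorm_lt_top_iff_lintegral_rpow_enorm_lt_top (by norm_num) (by norm_num)]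
  refine lt_of_le_of_lt (lintegral_mono fun ξ => ?_) h1
  rw [enorm_mul, ENNReal.mul_rpow_of_nonneg _ _ (by norm_num)]
  simp only [ENNReal.toReal_ofNat, ENNReal.rpow_ofNat, Real.rpow_one]
  gcongr
  rw [← ofReal_norm, ← ENNReal.ofReal_pow (norm_nonneg _)]
  refine ENNReal.ofReal_le_ofReal ?_
  simp only [norm_mul, Complex.norm_real, Complex.norm_I, mul_one, Complex.norm_ofNat,
    Real.norm_of_nonneg Real.pi_pos.le]
  have h3 : ‖ξ j‖ ^ 2 ≤ ‖ξ‖ ^ 2 := by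
    gcongr
    exact PiLp.norm_apply_le ξ j
  have h4 : 0 ≤ 4 * Real.pi ^ 2 := by positivity
  unfold jb
  nlinarith

theorem integral_bdd_mul_mul_le {φ a b : R3 → ℝ} {M : ℝ} {A B : ℝ≥0∞}
    (hφ : AEStronglyMeasurable φ)
    (hφM : ∀ᵐ x, |φ x| ≤ M) (ha : AEStronglyMeasurable a) (hb : AEStronglyMeasurable b)
    (hA : eLpNorm a 2 volume ≤ A) (hB : eLpNorm b 2 volume ≤ B) (hA' : A < ⊤) (hB' : B < ⊤) :
    Integrable (fun x => φ x * a x * b x) ∧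
      ‖∫ x, φ x * a x * b x‖ₑ ≤ ENNReal.ofReal M * A * B := by
  have h2 : ∀ c : R3 → ℝ, ∫⁻ x, ‖c x‖ₑ ^ 2 = eLpNorm c 2 volume ^ 2 := fun c => by
    rw [eLpNorm_eq_lintegral_rpow_enorm_toReal (by norm_num) (by norm_num),
      ← ENNReal.rpow_natCast, ← ENNReal.rpow_mul]
    simp
  have key : ∫⁻ x, ‖φ x * a x * b x‖ₑ ≤ ENNReal.ofReal M * A * B := by
    have h1 : ∫⁻ x, ‖a x‖ₑ * ‖b x‖ₑ ≤ A * B := by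
      refine (ENNReal.pow_right_strictMono two_ne_zero).le_iff_le.1 ?_
      refine (lintegral_mul_sq_le ha.enorm hb.enorm).trans ?_
      rw [h2, h2, mul_pow]
      gcongr
    calc ∫⁻ x, ‖φ x * a x * b x‖ₑ ≤ ∫⁻ x, ENNReal.ofReal M * (‖a x‖ₑ * ‖b x‖ₑ) := by
          refine lintegral_mono_ae ?_
          filter_upwards [hφM] with x hx
          rw [enorm_mul, enorm_mul, mul_assoc]
          gcongr
          rw [← ofReal_norm]
          exact ENNReal.ofReal_le_ofReal hx
      _ = ENNReal.ofReal M * ∫⁻ x, ‖a x‖ₑ * ‖b x‖ₑ :=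
          lintegral_const_mul' _ _ ENNReal.ofReal_ne_top
      _ ≤ ENNReal.ofReal M * (A * B) := by gcongr
      _ = _ := by ring
  refine ⟨⟨(hφ.mul ha).mul hb, key.trans_lt ?_⟩, (enorm_integral_le_lintegral_enorm _).trans key⟩
  exact ENNReal.mul_lt_top (ENNReal.mul_lt_top ENNReal.ofReal_lt_top hA') hB'

theorem vorticity_aestronglyMeasurable (f : L2) (j : Fin 3) :
    AEStronglyMeasurable (fun x => vorticity f x j) volume := by
  have h : ∀ P : R3 ≃ₗᵢ[ℝ] R3, AEStronglyMeasurable (fun x => f (P x)) volume := fun P =>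
    ((Lp.memLp f).comp_measurePreserving P.measurePreserving).1
  fin_cases j
  · exact Lp.aestronglyMeasurable f
  · exact (h P12).neg
  · exact (h P13).neg

theorem eLpNorm_vorticity (f : L2) (j : Fin 3) :
    eLpNorm (fun x => vorticity f x j) 2 volume = ‖f‖ₑ := by
  have h : ∀ P : R3 ≃ₗᵢ[ℝ] R3, eLpNorm (fun x => f (P x)) 2 volume = ‖f‖ₑ := fun P => by
    rw [Lp.enorm_def]
    exact eLpNorm_comp_measurePreserving (Lp.aestronglyMeasurable _) P.measurePreserving
  fin_cases j
  · exact (Lp.enorm_def f).symm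
  · exact (eLpNorm_neg (fun x => f (P12 x)) 2 volume).trans (h P12)
  · exact (eLpNorm_neg (fun x => f (P13 x)) 2 volume).trans (h P13)

theorem abs_vorticity_le {f : L2} (hf : Integrable (hat f)) (j : Fin 3) :
    ∀ᵐ x, |vorticity f x j| ≤ ∫ ξ, ‖hat f ξ‖ := by
  have h0 : ∀ᵐ x, |f x| ≤ ∫ ξ, ‖hat f ξ‖ := by
    filter_upwards [ae_eq_fourierInv_hat hf] with x hx
    have := norm_fourierInv_le (hat f : R3 → ℂ) x
    rwa [← hx, Complex.norm_real] at this
  have h : ∀ P : R3 ≃ₗᵢ[ℝ] R3, ∀ᵐ x, |f (P x)| ≤ ∫ ξ, ‖hat f ξ‖ := fun P =>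
    P.measurePreserving.quasiMeasurePreserving.ae h0
  fin_cases j
  · exact h0
  · filter_upwards [h P12] with x hx
    exact (abs_neg _).trans_le hx
  · filter_upwards [h P13] with x hx
    exact (abs_neg _).trans_le hx

theorem exists_integral_hat_bound {s : ℝ} (hs : 3 / 2 < s) :
    ∃ K : ℝ, 0 ≤ K ∧ ∀ f : L2, hsNorm s f < ⊤ → Integrable (hat f) ∧
      ∫ ξ, ‖hat f ξ‖ ≤ K * (hsNorm s f).toReal := by
  obtain ⟨K, hK, hb⟩ := exists_lintegral_hat_bound hs
  refine ⟨K.toReal, ENNReal.toReal_nonneg, fun f hf => ?_⟩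
  have h1 : K * hsNorm s f < ⊤ := ENNReal.mul_lt_top hK hf
  have h2 : Integrable (hat f) := ⟨Lp.aestronglyMeasurable _, (hb f).trans_lt h1⟩
  refine ⟨h2, ?_⟩
  rw [integral_norm_eq_lintegral_enorm h2.1, ← ENNReal.toReal_mul]
  exact ENNReal.toReal_mono h1.ne (hb f)

/-- The energy estimate for the polarized equation. -/
theorem exists_energy_bound {s : ℝ} (hs : 3 / 2 < s) :
    ∃ C : ℝ, 0 < C ∧ ∀ (g h r : L2) (dg dh ug uh : Fin 3 → R3 → ℝ),
      hsNorm s g < ⊤ → hsNorm s h < ⊤ →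
      (∀ j, IsWeakPartial j g (dg j)) → (∀ j, IsWeakPartial j h (dh j)) →
      (∀ j, IsWeakPartial j (fun x => velocity g x 0) (ug j)) →
      (∀ j, IsWeakPartial j (fun x => velocity h x 0) (uh j)) →
      (∀ᵐ x, 2 * r x + ∑ j, (velocity g x j * dh j x + velocity h x j * dg j x) -
        ∑ j, (vorticity g x j * uh j x + vorticity h x j * ug j x) = 0) →
      2 * ∫ x, r x * g x ≤ C * (hsNorm s h).toReal * ‖g‖ ^ 2 := by
  obtain ⟨K, hK, hvel⟩ := exists_velocity_term_bound hs
  obtain ⟨K', hK', hhat⟩ := exists_integral_hat_bound hs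
  -- Three velocity terms of size K and six stretching terms of size 3K'; the summand 1 secures
  -- positivity.
  refine ⟨3 * K.toReal + 18 * K' + 1, by positivity, ?_⟩
  intro g h r dg dh ug uh hg hh hdg hdh hug huh heq
  obtain ⟨hgi, -⟩ := hhat g hg
  obtain ⟨hhi, hhb⟩ := hhat h hh
  have hs1 : 1 ≤ s := by linarith
  choose Dg hDg hDg' using fun j => exists_weakPartial_hat (hdg j) (memLp_partial_hat hs1 hg j)
  choose Dh hDh hDh' using fun j => exists_weakPartial_hat (hdh j) (memLp_partial_hat hs1 hh j)
  set N := (hsNorm s h).toReal with hN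
  have hN0 : 0 ≤ N := ENNReal.toReal_nonneg
  -- The sup bound on the velocity serves integrability alone: for f = g it is not controlled by ‖g‖
  -- and does not enter the final estimate.
  have hvb : ∀ {f : L2}, Integrable (hat f) → ∀ (j : Fin 3) (a : L2),
      Integrable fun x => velocity f x j * a x * g x := fun {f} hf j a => by
    have hu : ∀ x, velocity f x j = (𝓕⁻ (velHat f j) x).re := fun x => by
      rw [← velocity_eq hf]; simp
    refine (integral_bdd_mul_mul_le (M := ∫ ξ, ‖velHat f j ξ‖) ?_ (Eventually.of_forall fun x => ?_)
      (Lp.aestronglyMeasurable a) (Lp.aestronglyMeasurable g) (Lp.enorm_def a).ge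
      (Lp.enorm_def g).ge enorm_lt_top enorm_lt_top).1
    · simp only [hu]
      exact (Complex.continuous_re.comp (continuous_fourierInv_of_integrable
        (integrable_velHat hf j))).aestronglyMeasurable
    · rw [hu]
      exact (Complex.abs_re_le_norm _).trans (norm_fourierInv_le _ _)
  have hM0 : 0 ≤ ∫ ξ, ‖hat h ξ‖ := integral_nonneg fun ξ => norm_nonneg _
  have real_bound : ∀ {I M A B : ℝ} {a b : ℝ≥0∞}, 0 ≤ M → 0 ≤ A → 0 ≤ B →
      ‖I‖ₑ ≤ ENNReal.ofReal M * a * b → a = ENNReal.ofReal A → b = ENNReal.ofReal B →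
      |I| ≤ M * A * B := fun {I M A B a b} hM hA hB h ha hb => by
    rw [ha, hb, ← ENNReal.ofReal_mul hM, ← ENNReal.ofReal_mul (by positivity), ← ofReal_norm] at h
    exact (ENNReal.ofReal_le_ofReal_iff (by positivity)).1 h
  have h1 : ∀ j, |∫ x, velocity g x j * Dh j x * g x| ≤ K.toReal * N * ‖g‖ ^ 2 := fun j => by
    have hj := hvel g h (Dh j) j hgi (hDh' j)
    refine real_bound (a := hsNorm s h) (b := ‖g‖ₑ ^ 2) ENNReal.toReal_nonneg hN0 (by positivity)
      ?_ (ENNReal.ofReal_toReal hh.ne).symm ?_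
    · rwa [ENNReal.ofReal_toReal hK.ne]
    · rw [ENNReal.ofReal_pow (norm_nonneg _), ofReal_norm]
  have h2 : ∑ j, ∫ x, velocity h x j * Dg j x * g x = 0 := sum_integral_transport hhi hDg'
  have h3 := fun j => integral_bdd_mul_mul_le (huh j).2.1.aestronglyMeasurable
    (abs_gradVelocity_le hhi (huh j)) (vorticity_aestronglyMeasurable g j)
    (Lp.aestronglyMeasurable g) (eLpNorm_vorticity g j).le (Lp.enorm_def g).ge enorm_lt_top
    enorm_lt_top
  have h4 := fun j => integral_bdd_mul_mul_le (vorticity_aestronglyMeasurable h j)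
    (abs_vorticity_le hhi j) (hug j).2.1.aestronglyMeasurable (Lp.aestronglyMeasurable g)
    (eLpNorm_gradVelocity_le hgi (hug j)).2 (Lp.enorm_def g).ge
    (ENNReal.mul_lt_top (by norm_num) enorm_lt_top) enorm_lt_top
  have h3' : ∀ j, |∫ x, uh j x * vorticity g x j * g x| ≤ 3 * K' * N * ‖g‖ ^ 2 := fun j => by
    have := real_bound (by positivity) (norm_nonneg g) (norm_nonneg g) (h3 j).2
      (ofReal_norm g).symm (ofReal_norm g).symm
    calc _ ≤ _ := this
      _ ≤ 3 * (K' * N) * ‖g‖ * ‖g‖ := by gcongr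
      _ = _ := by ring
  have h4' : ∀ j, |∫ x, vorticity h x j * ug j x * g x| ≤ 3 * K' * N * ‖g‖ ^ 2 := fun j => by
    have := real_bound (A := 3 * ‖g‖) hM0 (by positivity) (norm_nonneg g) (h4 j).2
      (by rw [ENNReal.ofReal_mul (by norm_num), ofReal_norm]; norm_num) (ofReal_norm g).symm
    calc _ ≤ _ := this
      _ ≤ K' * N * (3 * ‖g‖) * ‖g‖ := by gcongr
      _ = _ := by ring
  have i2 : ∀ j, Integrable fun x =>
      -(velocity g x j * Dh j x * g x) - velocity h x j * Dg j x * g x := fun j =>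
    (hvb hgi j (Dh j)).fun_neg.sub (hvb hhi j (Dg j))
  have hmain : 2 * ∫ x, r x * g x = ∑ j, (-(∫ x, velocity g x j * Dh j x * g x) -
      (∫ x, velocity h x j * Dg j x * g x) + (∫ x, uh j x * vorticity g x j * g x) +
      ∫ x, vorticity h x j * ug j x * g x) := by
    have hj : ∀ j, (-(∫ x, velocity g x j * Dh j x * g x) -
        (∫ x, velocity h x j * Dg j x * g x) + (∫ x, uh j x * vorticity g x j * g x) +
        ∫ x, vorticity h x j * ug j x * g x) = ∫ x, (-(velocity g x j * Dh j x * g x) -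
        (velocity h x j * Dg j x * g x) + (uh j x * vorticity g x j * g x) +
        vorticity h x j * ug j x * g x) := fun j => by
      rw [integral_add ((i2 j).fun_add (h3 j).1) (h4 j).1, integral_add (i2 j) (h3 j).1,
        integral_sub (hvb hgi j (Dh j)).fun_neg (hvb hhi j (Dg j)), integral_neg]
    simp only [hj]
    rw [← integral_finsetSum, ← integral_const_mul]
    · refine integral_congr_ae ?_
      have e1 : ∀ᵐ x, ∀ j, dg j x = Dg j x := ae_all_iff.2 hDg
      have e2 : ∀ᵐ x, ∀ j, dh j x = Dh j x := ae_all_iff.2 hDh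
      filter_upwards [heq, e1, e2] with x hx e1 e2
      simp only [e1, e2, Fin.sum_univ_three] at hx ⊢
      linear_combination (g x) * hx
    · intro j _
      exact ((i2 j).fun_add (h3 j).1).fun_add (h4 j).1
  rw [hmain]
  simp only [Fin.sum_univ_three] at h2 ⊢
  have a0 := abs_le.1 (h1 0)
  have a1 := abs_le.1 (h1 1)
  have a2 := abs_le.1 (h1 2)
  have b0 := abs_le.1 (h3' 0)
  have b1 := abs_le.1 (h3' 1)
  have b2 := abs_le.1 (h3' 2)
  have c0 := abs_le.1 (h4' 0)
  have c1 := abs_le.1 (h4' 1)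
  have c2 := abs_le.1 (h4' 2)
  have hp : 0 ≤ N * ‖g‖ ^ 2 := by positivity
  linarith

/-! ### The time evolution -/

/-- Grönwall's inequality with a continuous coefficient. -/
theorem le_mul_exp_integral {T : ℝ} {y y' κ : ℝ → ℝ} (hy : ContinuousOn y (Icc 0 T))
    (hy' : ∀ t ∈ Ioo 0 T, HasDerivAt y (y' t) t) (hκ : ContinuousOn κ (Icc 0 T))
    (hle : ∀ t ∈ Ioo 0 T, y' t ≤ κ t * y t) {t : ℝ} (ht : t ∈ Icc 0 T) :
    y t ≤ y 0 * Real.exp (∫ τ in (0 : ℝ)..t, κ τ) := by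
  have hT : 0 ≤ T := ht.1.trans ht.2
  -- The constant extension past the end points makes the coefficient continuous on ℝ, so its
  -- primitive is differentiable everywhere.
  set k : ℝ → ℝ := IccExtend hT ((Icc 0 T).domRestrict κ) with hk
  have hkc : Continuous k := hκ.domRestrict.Icc_extend'
  have hke : ∀ τ ∈ Icc 0 T, k τ = κ τ := fun τ hτ => by
    rw [hk, IccExtend_of_mem _ _ hτ]; rfl
  have hint : ∫ τ in (0 : ℝ)..t, κ τ = ∫ τ in (0 : ℝ)..t, k τ := by
    refine intervalIntegral.integral_congr fun τ hτ => (hke τ ?_).symm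
    rw [uIcc_of_le ht.1] at hτ
    exact ⟨hτ.1, hτ.2.trans ht.2⟩
  have hI : ∀ t, HasDerivAt (fun t => ∫ τ in (0 : ℝ)..t, k τ) (k t) t := fun t =>
    intervalIntegral.integral_hasDerivAt_right (hkc.intervalIntegrable _ _)
      (hkc.stronglyMeasurableAtFilter _ _) hkc.continuousAt
  have hE : ∀ t, HasDerivAt (fun t => Real.exp (-∫ τ in (0 : ℝ)..t, k τ))
      (Real.exp (-∫ τ in (0 : ℝ)..t, k τ) * -k t) t := fun t => (hI t).neg.exp
  have hanti : AntitoneOn (fun t => y t * Real.exp (-∫ τ in (0 : ℝ)..t, k τ)) (Icc 0 T) := by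
    refine antitoneOn_of_deriv_nonpos (convex_Icc 0 T)
      (hy.mul fun t _ => (hE t).continuousAt.continuousWithinAt) ?_ ?_
    · intro t ht
      rw [interior_Icc] at ht
      exact ((hy' t ht).mul (hE t)).differentiableAt.differentiableWithinAt
    · intro t ht
      rw [interior_Icc] at ht
      have hd : HasDerivAt (fun t => y t * Real.exp (-∫ τ in (0 : ℝ)..t, k τ)) _ t :=
        (hy' t ht).mul (hE t)
      rw [hd.deriv, hke t (Ioo_subset_Icc_self ht)]
      have := hle t ht
      have he := Real.exp_pos (-∫ τ in (0 : ℝ)..t, k τ)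
      nlinarith
  have h := hanti (left_mem_Icc.2 hT) ht ht.1
  simp only [intervalIntegral.integral_same, neg_zero, Real.exp_zero, mul_one] at h
  rw [hint]
  calc y t = y t * Real.exp (-∫ τ in (0 : ℝ)..t, k τ) * Real.exp (∫ τ in (0 : ℝ)..t, k τ) := by
        rw [mul_assoc, ← Real.exp_add]; simp
    _ ≤ _ := by gcongr

/-- For s ≥ 0 the H^s norm dominates the L² norm, so the difference quotients also converge in L².
-/
theorem HasDerivInNorm.hasDerivWithinAt {s T : ℝ} (hs : 0 ≤ s) {f f' : ℝ → L2}
    (h : HasDerivInNorm (hsNorm s) T f f') {t : ℝ} (ht : t ∈ Icc 0 T) :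
    HasDerivWithinAt f (f' t) (Icc 0 T) t := by
  rw [hasDerivWithinAt_iff_tendsto_slope, tendsto_iff_edist_tendsto_0]
  refine tendsto_of_tendsto_of_tendsto_of_le_of_le tendsto_const_nhds (h t ht)
    (fun _ => zero_le) fun τ => ?_
  simp only [edist_eq_enorm_sub, slope, vsub_eq_sub]
  exact enorm_le_hsNorm hs _

theorem continuousOn_hsNorm_add {s T : ℝ} {w v : ℝ → L2} (hw : IsSolution s T w)
    (hv : IsSolution s T v) :
    ContinuousOn (fun τ => (hsNorm s (w τ + v τ)).toReal) (Icc 0 T) := by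
  intro t ht
  have hfin : ∀ {w : ℝ → L2}, IsSolution s T w → hsNorm s (w t) < ⊤ := fun hw =>
    (hsNorm_le_hsDotNorm s _).trans_lt (hw.mem t ht).1
  have hft : hsNorm s (w t + v t) ≠ ⊤ :=
    ((hsNorm_add_le s _ _).trans_lt (ENNReal.add_lt_top.2 ⟨hfin hw, hfin hv⟩)).ne
  set e : ℝ → ℝ≥0∞ := fun τ => hsDotNorm s (w τ - w t) + hsDotNorm s (v τ - v t)
  have he : Tendsto e (𝓝[Icc 0 T] t) (𝓝 0) := by
    simpa using (hw.cont t ht).add (hv.cont t ht)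
  have hd : ∀ τ, hsNorm s (w τ + v τ - (w t + v t)) ≤ e τ := fun τ => by
    rw [show w τ + v τ - (w t + v t) = (w τ - w t) + (v τ - v t) by abel]
    exact (hsNorm_add_le s _ _).trans
      (add_le_add (hsNorm_le_hsDotNorm s _) (hsNorm_le_hsDotNorm s _))
  refine (ENNReal.tendsto_toReal hft).comp ?_
  have h1 : Tendsto (fun τ => hsNorm s (w t + v t) - e τ) (𝓝[Icc 0 T] t)
      (𝓝 (hsNorm s (w t + v t))) := by
    simpa using ENNReal.Tendsto.sub (tendsto_const_nhds (x := hsNorm s (w t + v t))) he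
      (Or.inl hft)
  have h2 : Tendsto (fun τ => hsNorm s (w t + v t) + e τ) (𝓝[Icc 0 T] t)
      (𝓝 (hsNorm s (w t + v t))) := by
    simpa using tendsto_const_nhds.add he
  refine tendsto_of_tendsto_of_tendsto_of_le_of_le h1 h2 (fun τ => ?_) (fun τ => ?_)
  · refine tsub_le_iff_right.2 ?_
    -- The reverse triangle inequality, with truncated subtraction because the norm at τ is not
    -- assumed finite here.
    have := hsNorm_sub_le s (w τ + v τ) (w τ + v τ - (w t + v t))
    rw [sub_sub_cancel] at this
    exact this.trans (by gcongr; exact hd τ)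
  · have := hsNorm_add_le s (w t + v t) (w τ + v τ - (w t + v t))
    rw [add_sub_cancel] at this
    exact this.trans (by gcongr; exact hd τ)

/-- The energy inequality for the difference of two solutions at a fixed time. -/
theorem exists_difference_bound {s : ℝ} (hs : 3 / 2 < s) :
    ∃ C : ℝ, 0 < C ∧ ∀ w v w' v' : L2, hsNorm s w < ⊤ → hsNorm s v < ⊤ →
      VorticityEqAt w w' → VorticityEqAt v v' →
      2 * inner ℝ (w - v) (w' - v') ≤ C * (hsNorm s (w + v)).toReal * ‖w - v‖ ^ 2 := by
  obtain ⟨C, hC, hE⟩ := exists_energy_bound hs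
  obtain ⟨K', -, hhat⟩ := exists_integral_hat_bound hs
  refine ⟨C, hC, ?_⟩
  rintro w v w' v' hw hv ⟨dw, uw, hdw, huw, hweq⟩ ⟨dv, uv, hdv, huv, hveq⟩
  obtain ⟨hwi, -⟩ := hhat w hw
  obtain ⟨hvi, -⟩ := hhat v hv
  have hsub := Lp.coeFn_sub w v
  have hadd := Lp.coeFn_add w v
  -- Polarization B(w,w) - B(v,v) = ½ (B(g,h) + B(h,g)); the factor ½ is the reason for 2r in the
  -- energy bound. The weak derivatives of g and h are differences and sums of the given ones.
  have h := hE (w - v) (w + v) (w' - v') (fun j x => dw j x - dv j x) (fun j x => dw j x + dv j x)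
    (fun j x => uw j x - uv j x) (fun j x => uw j x + uv j x)
    ((hsNorm_sub_le s w v).trans_lt (ENNReal.add_lt_top.2 ⟨hw, hv⟩))
    ((hsNorm_add_le s w v).trans_lt (ENNReal.add_lt_top.2 ⟨hw, hv⟩))
    (fun j => isWeakPartial_congr ((hdw j).sub (hdv j)) hsub.symm)
    (fun j => isWeakPartial_congr ((hdw j).add (hdv j)) hadd.symm)
    (fun j => by simpa only [velocity_sub hwi hvi, PiLp.sub_apply] using (huw j).sub (huv j))
    (fun j => by simpa only [velocity_add hwi hvi, PiLp.add_apply] using (huw j).add (huv j)) ?_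
  · refine le_of_eq_of_le ?_ h
    rw [L2.inner_def]
    rfl
  · have hP : ∀ (P : R3 ≃ₗᵢ[ℝ] R3) {p : R3 → Prop}, (∀ᵐ x, p x) → ∀ᵐ x, p (P x) := fun P _ h =>
      P.measurePreserving.quasiMeasurePreserving.ae h
    filter_upwards [hweq, hveq, Lp.coeFn_sub w' v', hsub, hadd, hP P12 hsub, hP P12 hadd,
      hP P13 hsub, hP P13 hadd] with x h1 h2 h3 h4 h5 h6 h7 h8 h9
    simp only [velocity_sub hwi hvi, velocity_add hwi hvi, PiLp.sub_apply, PiLp.add_apply, h3,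
      Pi.sub_apply, Pi.add_apply, Fin.sum_univ_three, vorticity, h4, h5, h6, h7, h8, h9] at h1 h2 ⊢
    simp only [Matrix.cons_val_zero, Matrix.cons_val_one, Matrix.cons_val] at h1 h2 ⊢
    linear_combination 2 * h1 - 2 * h2

end
end PermEuler

/-! ### Stability in L² and uniqueness of solutions -/

theorem mainTheorem4 (s : ℝ) (hs : 3 / 2 < s) :
    (∃ C : ℝ, 0 < C ∧
      ∀ (T : ℝ) (w v : ℝ → PermEuler.L2), 0 < T →
        PermEuler.IsSolution s T w → PermEuler.IsSolution s T v →
        ∀ t ∈ Set.Icc 0 T,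
          ‖w t - v t‖ ^ 2 ≤
            ‖w 0 - v 0‖ ^ 2 *
              Real.exp (C * ∫ τ in (0 : ℝ)..t, (PermEuler.hsNorm s (w τ + v τ)).toReal)) ∧
    (∀ (T : ℝ) (w v : ℝ → PermEuler.L2), 0 < T →
        PermEuler.IsSolution s T w → PermEuler.IsSolution s T v →
        w 0 = v 0 → ∀ t ∈ Set.Icc 0 T, w t = v t) := by
  have hmain : ∃ C : ℝ, 0 < C ∧
      ∀ (T : ℝ) (w v : ℝ → PermEuler.L2), 0 < T →
        PermEuler.IsSolution s T w → PermEuler.IsSolution s T v →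
        ∀ t ∈ Set.Icc 0 T,
          ‖w t - v t‖ ^ 2 ≤
            ‖w 0 - v 0‖ ^ 2 *
              Real.exp (C * ∫ τ in (0 : ℝ)..t, (PermEuler.hsNorm s (w τ + v τ)).toReal) := by
    obtain ⟨C, hC, hE⟩ := PermEuler.exists_difference_bound hs
    refine ⟨C, hC, fun T w v _ hw hv t ht => ?_⟩
    obtain ⟨w', -, -, hwd, hweq⟩ := hw.evolution
    obtain ⟨v', -, -, hvd, hveq⟩ := hv.evolution
    -- This makes the time derivative in H^{s-1} a derivative in L², so ‖w - v‖² can be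
    -- differentiated.
    have hs0 : 0 ≤ s - 1 := by linarith
    have hd : ∀ t ∈ Set.Icc 0 T, HasDerivWithinAt (fun t => ‖w t - v t‖ ^ 2)
        (2 * inner ℝ (w t - v t) (w' t - v' t)) (Set.Icc 0 T) t := fun t ht =>
      ((hwd.hasDerivWithinAt hs0 ht).sub (hvd.hasDerivWithinAt hs0 ht)).norm_sq
    rw [← intervalIntegral.integral_const_mul]
    refine PermEuler.le_mul_exp_integral (fun t ht => (hd t ht).continuousWithinAt)
      (fun t ht => (hd t (Set.Ioo_subset_Icc_self ht)).hasDerivAt (Icc_mem_nhds ht.1 ht.2))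
      ((PermEuler.continuousOn_hsNorm_add hw hv).const_smul C) (fun t ht => ?_) ht
    have ht' := Set.Ioo_subset_Icc_self ht
    exact hE _ _ _ _ ((PermEuler.hsNorm_le_hsDotNorm s _).trans_lt (hw.mem t ht').1)
      ((PermEuler.hsNorm_le_hsDotNorm s _).trans_lt (hv.mem t ht').1) (hweq t ht') (hveq t ht')
  refine ⟨hmain, fun T w v hT hw hv h0 t ht => ?_⟩
  obtain ⟨C, -, hE⟩ := hmain
  have h := hE T w v hT hw hv t ht
  rw [h0, sub_self, norm_zero, zero_pow two_ne_zero, zero_mul] at h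
  have h' : ‖w t - v t‖ = 0 := (pow_eq_zero_iff two_ne_zero).1 (le_antisymm h (sq_nonneg _))
  exact sub_eq_zero.1 (norm_eq_zero.1 h')
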